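/- Let $\nu$ be a probability measure on $[0,\infty)$ and let $\{\xi_v: v\in\mathbb Z^2\}$ be independent random variables with law $\nu$. The vertex set of an upright path (a finite lattice path with steps $(1,0)$ and $(0,1)$) has weight $\ell(\gamma)=\sum_{v\in\gamma}\xi_v$. For reals $a,b$ let $X_{a,b}$ be the maximum weight of an upright path from $(1,1)$ to $(\lfloor a\rfloor,\lfloor b\rfloor)$, and let $\mu=\lim_{r\to\infty} r^{-1}\,\mathbb E[X_{r,r}]$. The transversal fluctuation $\mathrm{TF}(\gamma)$ of a path is the maximum Euclidean distance of its vertices from the diagonal $y=x$. Assume: 1. $\nu(\{0\})=0$ and $\mu<\infty$. 2. There are positive constants $\rho<1$, $G_1,G_2,g_1,g_2$ such that, for all large enough $r\in\mathbb N$ and all $x\in[-\rho,\rho]$, $$\mathbb E[X_{r(1-x),r(1+x)}]-\mu r\in\big[-G_1x^2r-g_1r^{1/3},\,-G_2x^2r-g_2r^{1/3}\big].$$ 3. For each $\delta>0$ there are positive constants $c',\theta_0,r_0$ such that, for all $x$ with $|x|\le 1-\delta$, all $r\in\mathbb N$ with $r>r_0$ and all $\theta>\theta_0$, writing $Y=X_{r(1+x),r(1-x)}$,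 $$\mathbb P\big(Y-\mathbb E[Y]>\theta r^{1/3}\big)\le e^{-c'\min(\theta^{3/2},\,\theta r^{1/3})}\quad\text{and}\quad \mathbb P\big(Y-\mathbb E[Y]<-\theta r^{1/3}\big)\le e^{-c'\theta^{3/2}}.$$ Then there exist constants $c,c_1,C_1>0$ and $k_0\in\mathbb N$ such that, for all positive integers $n,k,m$ with $k_0\le k\le c_1n$ and $m\le k$, the following holds with probability at least $1-e^{-ckm}$: there are $m$ pairwise disjoint upright paths $\gamma_1,\dots,\gamma_m$ in the square $\{1,\dots,n\}^2$, with $\gamma_i$ running from $(1,m-i+1)$ to $(n,n-i+1)$, such that $\max_i\mathrm{TF}(\gamma_i)\le 2mk^{-2/3}n^{2/3}$ and $$\sum_{i=1}^m\ell(\gamma_i)\ \ge\ \mu nm-C_1mk^{2/3}n^{1/3}.$$ -/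

import Mathlib

open Filter MeasureTheory Set
open scoped ENNReal Topology

noncomputable section

namespace LPP

/-- An upright path in `ℤ²` from `u` to `v`: a finite sequence of vertices, each increment of which
is `(1, 0)` or `(0, 1)`. -/
structure UprightPath (u v : ℤ × ℤ) where
  len : ℕ
  pt : Fin (len + 1) → ℤ × ℤ
  pt_zero : pt 0 = u
  pt_last : pt (Fin.last len) = v
  step : ∀ i : Fin len, pt i.succ = pt i.castSucc + (1, 0) ∨ pt i.succ = pt i.castSucc + (0, 1)

/-- The set of vertices visited by a path. -/
def UprightPath.vertices {u v : ℤ × ℤ} (γ : UprightPath u v) : Finset (ℤ × ℤ) :=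
  Finset.univ.image γ.pt

/-- The weight `ℓ(γ)` of a path in the environment `ξ`: the sum of the values at its vertices. -/
def UprightPath.weight {u v : ℤ × ℤ} (γ : UprightPath u v) (ξ : ℤ × ℤ → ℝ) : ℝ :=
  ∑ w ∈ γ.vertices, ξ w

/-- The diagonal `y = x` of the Euclidean plane. -/
def diagonalLine : Set (EuclideanSpace ℝ (Fin 2)) := {p | p 1 = p 0}

/-- The transversal fluctuation of a path: the maximum Euclidean distance between a vertex of
the path and the diagonal `y = x`. -/
def UprightPath.tf {u v : ℤ × ℤ} (γ : UprightPath u v) : ℝ :=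
  ⨆ i : Fin (γ.len + 1), Metric.infDist !₂[((γ.pt i).1 : ℝ), ((γ.pt i).2 : ℝ)] diagonalLine

/-- The last passage value `X_{u → v}`: the maximum weight of an upright path from `u` to `v`. -/
def lastPassage (u v : ℤ × ℤ) (ξ : ℤ × ℤ → ℝ) : ℝ :=
  ⨆ γ : UprightPath u v, γ.weight ξ

/-- `X_{a,b}`: the last passage value from `(1, 1)` to `(a, b)`; real coordinates are
rounded down. -/
def X (a b : ℝ) (ξ : ℤ × ℤ → ℝ) : ℝ :=
  lastPassage (1, 1) (⌊a⌋, ⌊b⌋) ξ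

/-- The law of the environment: independent vertex values with common distribution `ν`. -/
def envLaw (ν : Measure ℝ) [IsProbabilityMeasure ν] : Measure (ℤ × ℤ → ℝ) :=
  Measure.infinitePi fun _ : ℤ × ℤ => ν

/-- The mean `𝔼[X_{a,b}]`. -/
def meanX (ν : Measure ℝ) [IsProbabilityMeasure ν] (a b : ℝ) : ℝ :=
  ∫ ξ, X a b ξ ∂(envLaw ν)

/-- The growth rate `lim r⁻¹ 𝔼[X_{r,r}]`, possibly infinite. The limit exists by superadditivity;
the upper limit names its value. -/
def growthRateENN (ν : Measure ℝ) [IsProbabilityMeasure ν] : ℝ≥0∞ :=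
  limsup (fun r : ℕ => (∫⁻ ξ, ENNReal.ofReal (X r r ξ) ∂(envLaw ν)) / (r : ℝ≥0∞)) atTop

/-- The growth rate `μ` as a real number; it is used only where it is assumed to be finite. -/
def growthRate (ν : Measure ℝ) [IsProbabilityMeasure ν] : ℝ :=
  (growthRateENN ν).toReal

/-- No atom at zero, and finiteness of the growth rate. -/
def NoAtomFiniteGrowth (ν : Measure ℝ) [IsProbabilityMeasure ν] : Prop :=
  ν {0} = 0 ∧ growthRateENN ν < ∞

/-- Strong concavity of the limit shape around the diagonal, and non-random fluctuations. -/
def StrongConcavity (ν : Measure ℝ) [IsProbabilityMeasure ν] : Prop :=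
  ∃ ρ G₁ G₂ g₁ g₂ : ℝ, 0 < ρ ∧ ρ < 1 ∧ 0 < G₁ ∧ 0 < G₂ ∧ 0 < g₁ ∧ 0 < g₂ ∧
    ∃ r₀ : ℕ, ∀ r : ℕ, r₀ ≤ r → ∀ x : ℝ, |x| ≤ ρ →
      meanX ν (r * (1 - x)) (r * (1 + x)) - growthRate ν * r ∈
        Icc (-G₁ * x ^ 2 * r - g₁ * (r : ℝ) ^ (1 / 3 : ℝ))
          (-G₂ * x ^ 2 * r - g₂ * (r : ℝ) ^ (1 / 3 : ℝ))

/-- Moderate and large deviation estimates for the point-to-point weight, uniform in directions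
that are bounded away from the axes. -/
def DeviationEstimates (ν : Measure ℝ) [IsProbabilityMeasure ν] : Prop :=
  ∀ δ : ℝ, 0 < δ → ∃ c θ₀ r₀ : ℝ, 0 < c ∧ 0 < θ₀ ∧ 0 < r₀ ∧
    ∀ x : ℝ, |x| ≤ 1 - δ → ∀ r : ℕ, r₀ < r → ∀ θ : ℝ, θ₀ < θ →
      (envLaw ν).real {ξ | X (r * (1 + x)) (r * (1 - x)) ξ
            - meanX ν (r * (1 + x)) (r * (1 - x)) > θ * (r : ℝ) ^ (1 / 3 : ℝ)}
          ≤ Real.exp (-c * min (θ ^ (3 / 2 : ℝ)) (θ * (r : ℝ) ^ (1 / 3 : ℝ))) ∧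
      (envLaw ν).real {ξ | X (r * (1 + x)) (r * (1 - x)) ξ
            - meanX ν (r * (1 + x)) (r * (1 - x)) < -θ * (r : ℝ) ^ (1 / 3 : ℝ)}
          ≤ Real.exp (-c * θ ^ (3 / 2 : ℝ))

/-- In the environment `ξ` there are `m` disjoint upright paths in the square `⟦1, n⟧²` with
transversal fluctuation at most `T` and total weight at least `W`. With indices counted from `1`,
the `i`-th path runs from `(1, m - i + 1)` to `(n, n - i + 1)`; below, `i` counts from `0`. -/
def HasDisjointPaths (n m : ℕ) (T W : ℝ) (ξ : ℤ × ℤ → ℝ) : Prop :=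
  ∃ γ : (i : Fin m) → UprightPath (1, (m : ℤ) - (i : ℕ)) ((n : ℤ), (n : ℤ) - (i : ℕ)),
    (∀ i j, i ≠ j → Disjoint (γ i).vertices (γ j).vertices) ∧
    (∀ i, ∀ w ∈ (γ i).vertices, 1 ≤ w.1 ∧ w.1 ≤ n ∧ 1 ≤ w.2 ∧ w.2 ≤ n) ∧
    (∀ i, (γ i).tf ≤ T) ∧
    W ≤ ∑ i, (γ i).weight ξ

end LPP

end

/-! Put `δ = (n/k)^{1/3}`. A segment of length `δ³` fluctuates on the scale `δ` in weight and `δ²`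
transversally. In the bulk each path consists of order `k` such segments, each confined to a
diagonal strip of width of order `δ²`; the strips of different paths are disjoint, so the segment
deficits (`μ` times length, minus weight) are independent. If they have exponential tails on the
scale `δ`, a Chernoff bound makes the total deficit of the `m` paths `O(kmδ)`, which is `O(m k^{2/3}
n^{1/3})`, outside probability `e^{-km}`. Lengths are powers `8^j`, so that the scales `2^j` and
`4^j` are exact.

Two points need work. First, confinement to a strip. `exists_segPassage_lower_bound` shows that,
with probability close to one, an optimal path stays in a strip of width of order `M * 4^j`: a path
through a far vertex `b` would, after being extended along the diagonal line through `b`, give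
point-to-point weights violating the parabolic bound. The extension needs lower bounds simultaneous
over all positions of `b` on the line, which come from chaining a subadditive deficit over scales.
`exists_exponential_moment` then upgrades constant probability to an exponential moment: a segment
splits into eight independent ones whose natural scale is half as large, and a bad event of small
constant probability is absorbed by the elementary bound `x ≤ 256 + x² / 1024`.

Second, the paths must start and end next to each other, with no room for wide strips. The levels
therefore climb from `1` to `J`, with `8^J` comparable to `n/k`, while the gaps between the paths
grow like `4^j`; of order `k` segments are spent on each level. Lengths and scales sum
geometrically, so the top level dominates both. After a bulk stretch the climb is reversed.
`HasSchedule` encodes this, `exists_disjoint_pathSets` attaches explicit end pieces, and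
`measureReal_sum_deficit_le` is the Chernoff bound, treating all levels together. -/

noncomputable section

namespace LPP

/-! ### Vertex sets of upright paths. -/

/-- `IsPathSet u v A`: the finite set `A` is the vertex set of an upright path from `u` to `v`. -/
inductive IsPathSet (u : ℤ × ℤ) : ℤ × ℤ → Finset (ℤ × ℤ) → Prop
  | single : IsPathSet u u {u}
  | snoc {v w : ℤ × ℤ} {A : Finset (ℤ × ℤ)} : IsPathSet u v A →
      (w = v + (1, 0) ∨ w = v + (0, 1)) → IsPathSet u w (insert w A)

theorem isPathSet_image (n : ℕ) (p : Fin (n + 1) → ℤ × ℤ)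
    (h : ∀ i : Fin n, p i.succ = p i.castSucc + (1, 0) ∨ p i.succ = p i.castSucc + (0, 1)) :
    IsPathSet (p 0) (p (Fin.last n)) (Finset.univ.image p) := by
  induction n with
  | zero =>
    have : Finset.univ.image p = {p 0} := by
      ext x; simp [eq_comm (a := x)]
    rw [this]
    exact .single
  | succ n ih =>
    have h1 := ih (fun i => p i.castSucc) (fun i => by simpa using h i.castSucc)
    have h2 := IsPathSet.snoc h1 (w := p (Fin.last (n + 1))) (by simpa using h (Fin.last n))
    have : Finset.univ.image p
        = insert (p (Fin.last (n + 1))) (Finset.univ.image fun i : Fin (n + 1) => p i.castSucc) := by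
      ext x
      simp only [Finset.mem_image, Finset.mem_univ, true_and, Finset.mem_insert]
      constructor
      · rintro ⟨i, rfl⟩
        refine Fin.lastCases (Or.inl rfl) (fun i => Or.inr ⟨i, rfl⟩) i
      · rintro (rfl | ⟨i, rfl⟩)
        exacts [⟨_, rfl⟩, ⟨_, rfl⟩]
    rw [this]
    exact h2

theorem UprightPath.isPathSet {u v : ℤ × ℤ} (γ : UprightPath u v) : IsPathSet u v γ.vertices := by
  have := isPathSet_image γ.len γ.pt γ.step
  rwa [γ.pt_zero, γ.pt_last] at this

theorem IsPathSet.exists_path {u v : ℤ × ℤ} {A : Finset (ℤ × ℤ)} (h : IsPathSet u v A) :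
    ∃ γ : UprightPath u v, γ.vertices = A := by
  induction h with
  | single =>
    refine ⟨⟨0, fun _ => u, rfl, rfl, fun i => i.elim0⟩, ?_⟩
    ext x; simp [UprightPath.vertices, eq_comm]
  | @snoc v w A h hw ih =>
    obtain ⟨γ, rfl⟩ := ih
    refine ⟨⟨γ.len + 1, Fin.snoc (α := fun _ => ℤ × ℤ) γ.pt w, ?_, ?_, ?_⟩, ?_⟩
    · rw [show (0 : Fin (γ.len + 1 + 1)) = (0 : Fin (γ.len + 1)).castSucc from rfl, Fin.snoc_castSucc]
      exact γ.pt_zero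
    · simp
    · intro i
      refine Fin.lastCases ?_ (fun i => ?_) i
      · simpa [γ.pt_last] using hw
      · have := γ.step i
        rw [Fin.succ_castSucc, Fin.snoc_castSucc, Fin.snoc_castSucc]
        exact this
    · ext x
      simp only [UprightPath.vertices, Finset.mem_image, Finset.mem_univ, true_and,
        Finset.mem_insert]
      constructor
      · rintro ⟨i, rfl⟩
        refine Fin.lastCases ?_ (fun i => ?_) i
        · simp
        · right; exact ⟨i, by simp⟩
      · rintro (rfl | ⟨i, rfl⟩)
        · exact ⟨Fin.last _, by simp⟩
        · exact ⟨i.castSucc, by simp⟩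

namespace IsPathSet

variable {u v w b : ℤ × ℤ} {A B : Finset (ℤ × ℤ)}

theorem left_mem (h : IsPathSet u v A) : u ∈ A := by
  induction h with
  | single => simp
  | snoc _ _ ih => simp [ih]

theorem right_mem (h : IsPathSet u v A) : v ∈ A := by
  cases h <;> simp

theorem le_right (h : IsPathSet u v A) : ∀ a ∈ A, a.1 ≤ v.1 ∧ a.2 ≤ v.2 := by
  induction h with
  | single => simp
  | snoc _ hw ih =>
    intro a ha
    rcases Finset.mem_insert.1 ha with rfl | ha
    · simp
    · have := ih a ha
      rcases hw with rfl | rfl <;> simp <;> omega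

theorem left_le (h : IsPathSet u v A) : ∀ a ∈ A, u.1 ≤ a.1 ∧ u.2 ≤ a.2 := by
  induction h with
  | single => simp
  | snoc h hw ih =>
    intro a ha
    rcases Finset.mem_insert.1 ha with rfl | ha
    · have := ih _ h.right_mem
      rcases hw with rfl | rfl <;> simp <;> omega
    · exact ih a ha

theorem trans (h : IsPathSet u v A) (h' : IsPathSet v w B) : IsPathSet u w (A ∪ B) := by
  induction h' with
  | single =>
    rw [Finset.union_comm, Finset.singleton_union, Finset.insert_eq_of_mem h.right_mem]
    exact h
  | snoc _ hw ih =>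
    rw [Finset.union_insert]
    exact ih.snoc hw

theorem join {v' : ℤ × ℤ} (h : IsPathSet u v A) (hv : v' = v + (1, 0) ∨ v' = v + (0, 1))
    (h' : IsPathSet v' w B) : IsPathSet u w (A ∪ B) := by
  have := (h.snoc hv).trans h'
  rwa [Finset.insert_union, ← Finset.union_insert, Finset.insert_eq_of_mem h'.left_mem] at this

/-- Concatenation across a diagonal step, through the vertex `v + (1, 0)`. -/
theorem joinDiag (h : IsPathSet u v A) (h' : IsPathSet (v + (1, 1)) w B) :
    IsPathSet u w (insert (v + (1, 0)) A ∪ B) :=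
  (h.snoc (Or.inl rfl)).join (Or.inr (by ext <;> simp)) h'

theorem split (h : IsPathSet u v A) (hb : b ∈ A) :
    ∃ A₁ A₂, IsPathSet u b A₁ ∧ IsPathSet b v A₂ ∧ A = A₁ ∪ A₂ := by
  induction h with
  | single =>
    obtain rfl : b = u := by simpa using hb
    exact ⟨{b}, {b}, .single, .single, by simp⟩
  | @snoc v w A h hw ih =>
    rcases Finset.mem_insert.1 hb with rfl | hb
    · exact ⟨insert b A, {b}, h.snoc hw, .single, by ext x; simp⟩
    · obtain ⟨A₁, A₂, h₁, h₂, rfl⟩ := ih hb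
      exact ⟨A₁, insert w A₂, h₁, h₂.snoc hw, by rw [Finset.union_insert]⟩

/-- A discrete intermediate value property, because `y - x` changes by one at each step. It locates
a vertex of the path exactly on the line bounding a strip that the path leaves. -/
theorem exists_diff_eq_of_le (h : IsPathSet u v A) {c : ℤ} (hu : u.2 - u.1 ≤ c)
    (ha : ∃ a ∈ A, c ≤ a.2 - a.1) : ∃ b ∈ A, b.2 - b.1 = c := by
  induction h with
  | single =>
    obtain ⟨a, ha, hc⟩ := ha
    obtain rfl : a = u := by simpa using ha
    exact ⟨a, ha, le_antisymm hu hc⟩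
  | @snoc v w A h hw ih =>
    by_cases hA : ∃ a ∈ A, c ≤ a.2 - a.1
    · obtain ⟨b, hb, hbc⟩ := ih hA
      exact ⟨b, Finset.mem_insert_of_mem hb, hbc⟩
    · push Not at hA
      obtain ⟨a, ha, hc⟩ := ha
      have hv := hA v h.right_mem
      rcases Finset.mem_insert.1 ha with rfl | ha
      · refine ⟨a, Finset.mem_insert_self _ _, ?_⟩
        rcases hw with rfl | rfl <;> simp at * <;> omega
      · exact absurd hc (not_le.2 (hA a ha))

theorem exists_diff_eq_of_ge (h : IsPathSet u v A) {c : ℤ} (hu : c ≤ u.2 - u.1)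
    (ha : ∃ a ∈ A, a.2 - a.1 ≤ c) : ∃ b ∈ A, b.2 - b.1 = c := by
  induction h with
  | single =>
    obtain ⟨a, ha, hc⟩ := ha
    obtain rfl : a = u := by simpa using ha
    exact ⟨a, ha, le_antisymm hc hu⟩
  | @snoc v w A h hw ih =>
    by_cases hA : ∃ a ∈ A, a.2 - a.1 ≤ c
    · obtain ⟨b, hb, hbc⟩ := ih hA
      exact ⟨b, Finset.mem_insert_of_mem hb, hbc⟩
    · push Not at hA
      obtain ⟨a, ha, hc⟩ := ha
      have hv := hA v h.right_mem
      rcases Finset.mem_insert.1 ha with rfl | ha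
      · refine ⟨a, Finset.mem_insert_self _ _, ?_⟩
        rcases hw with rfl | rfl <;> simp at * <;> omega
      · exact absurd hc (not_le.2 (hA a ha))

theorem exists_horizontal (x₀ y : ℤ) (n : ℕ) :
    ∃ A, IsPathSet (x₀, y) (x₀ + n, y) A ∧ ∀ a ∈ A, a.2 = y := by
  induction n with
  | zero => exact ⟨{(x₀, y)}, by simpa using IsPathSet.single, by simp⟩
  | succ n ih =>
    obtain ⟨A, hA, h⟩ := ih
    refine ⟨_, hA.snoc (w := (x₀ + (n + 1 : ℕ), y)) (Or.inl (by ext <;> simp; ring)), ?_⟩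
    intro a ha
    rcases Finset.mem_insert.1 ha with rfl | ha
    · rfl
    · exact h a ha

theorem exists_vertical (x y₀ : ℤ) (n : ℕ) :
    ∃ A, IsPathSet (x, y₀) (x, y₀ + n) A ∧ ∀ a ∈ A, a.1 = x := by
  induction n with
  | zero => exact ⟨{(x, y₀)}, by simpa using IsPathSet.single, by simp⟩
  | succ n ih =>
    obtain ⟨A, hA, h⟩ := ih
    refine ⟨_, hA.snoc (w := (x, y₀ + (n + 1 : ℕ))) (Or.inr (by ext <;> simp; ring)), ?_⟩
    intro a ha
    rcases Finset.mem_insert.1 ha with rfl | ha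
    · rfl
    · exact h a ha

/-- A horizontal leg, a vertical leg, and a second horizontal leg. -/
theorem exists_threeLegs {x₀ y₀ x₁ y₁ x₂ : ℤ} (h₁ : x₀ ≤ x₁) (h₂ : y₀ ≤ y₁) (h₃ : x₁ ≤ x₂) :
    ∃ A, IsPathSet (x₀, y₀) (x₂, y₁) A ∧ ∀ a ∈ A, x₀ ≤ a.1 ∧ a.1 ≤ x₂ ∧ y₀ ≤ a.2 ∧ a.2 ≤ y₁ ∧
      (a.2 = y₀ ∧ a.1 ≤ x₁ ∨ a.1 = x₁ ∨ a.2 = y₁ ∧ x₁ ≤ a.1) := by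
  obtain ⟨A, hA, hA'⟩ := exists_horizontal x₀ y₀ (x₁ - x₀).toNat
  obtain ⟨B, hB, hB'⟩ := exists_vertical x₁ y₀ (y₁ - y₀).toNat
  obtain ⟨C, hC, hC'⟩ := exists_horizontal x₁ y₁ (x₂ - x₁).toNat
  rw [Int.toNat_of_nonneg (by omega), add_sub_cancel] at hA hB hC
  refine ⟨_, (hA.trans hB).trans hC, ?_⟩
  intro a ha
  simp only [Finset.mem_union] at ha
  rcases ha with (ha | ha) | ha
  · have := hA' a ha; have h1 := hA.left_le a ha; have h2 := hA.le_right a ha; simp only at *; omega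
  · have := hB' a ha; have h1 := hB.left_le a ha; have h2 := hB.le_right a ha; simp only at *; omega
  · have := hC' a ha; have h1 := hC.left_le a ha; have h2 := hC.le_right a ha; simp only at *; omega

theorem exists_of_le (h₁ : u.1 ≤ v.1) (h₂ : u.2 ≤ v.2) : ∃ A, IsPathSet u v A := by
  obtain ⟨A, hA, -⟩ := exists_threeLegs h₁ h₂ le_rfl
  exact ⟨A, hA⟩

theorem subset_Icc (h : IsPathSet u v A) : A ⊆ Finset.Icc u v := by
  intro a ha
  have h1 := h.left_le a ha
  have h2 := h.le_right a ha
  rw [Finset.mem_Icc]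
  exact ⟨⟨h1.1, h1.2⟩, ⟨h2.1, h2.2⟩⟩

theorem translate (h : IsPathSet u v A) (z : ℤ × ℤ) :
    IsPathSet (u + z) (v + z) (A.image (· + z)) := by
  induction h with
  | single => simpa using IsPathSet.single
  | snoc _ hw ih =>
    rw [Finset.image_insert]
    refine ih.snoc ?_
    rcases hw with rfl | rfl
    · left; abel
    · right; abel

end IsPathSet

/-! ### Passage values restricted to a set of vertices. -/

/-- The maximum weight, in the environment `|ξ|`, of an upright path from `u` to `v` all of whose
vertices lie in `S`; it is zero if there is no such path. -/
def passage (S : Set (ℤ × ℤ)) (u v : ℤ × ℤ) (ξ : ℤ × ℤ → ℝ) : ℝ :=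
  ⨆ A : {A : Finset (ℤ × ℤ) // IsPathSet u v A ∧ (A : Set (ℤ × ℤ)) ⊆ S}, ∑ w ∈ A.1, |ξ w|

instance finite_pathSets (S : Set (ℤ × ℤ)) (u v : ℤ × ℤ) :
    Finite {A : Finset (ℤ × ℤ) // IsPathSet u v A ∧ (A : Set (ℤ × ℤ)) ⊆ S} := by
  refine Finite.of_injective
    (fun A => (⟨A.1, Finset.mem_powerset.2 A.2.1.subset_Icc⟩ : (Finset.Icc u v).powerset)) ?_
  intro A B h
  simpa [Subtype.ext_iff] using h

section passage

variable {S : Set (ℤ × ℤ)} {u v w b : ℤ × ℤ} {A : Finset (ℤ × ℤ)} {ξ : ℤ × ℤ → ℝ}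

theorem le_passage (h : IsPathSet u v A) (hS : (A : Set (ℤ × ℤ)) ⊆ S) (ξ : ℤ × ℤ → ℝ) :
    ∑ w ∈ A, |ξ w| ≤ passage S u v ξ :=
  le_ciSup (f := fun A : {A : Finset (ℤ × ℤ) // IsPathSet u v A ∧ (A : Set (ℤ × ℤ)) ⊆ S} =>
    ∑ w ∈ A.1, |ξ w|) (Set.finite_range _).bddAbove ⟨A, h, hS⟩

theorem passage_nonneg (S : Set (ℤ × ℤ)) (u v : ℤ × ℤ) (ξ : ℤ × ℤ → ℝ) : 0 ≤ passage S u v ξ :=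
  Real.iSup_nonneg fun _ => Finset.sum_nonneg fun _ _ => abs_nonneg _

theorem exists_eq_passage (h : IsPathSet u v A) (hS : (A : Set (ℤ × ℤ)) ⊆ S) (ξ : ℤ × ℤ → ℝ) :
    ∃ B, IsPathSet u v B ∧ (B : Set (ℤ × ℤ)) ⊆ S ∧ ∑ w ∈ B, |ξ w| = passage S u v ξ := by
  have : Nonempty {A : Finset (ℤ × ℤ) // IsPathSet u v A ∧ (A : Set (ℤ × ℤ)) ⊆ S} := ⟨⟨A, h, hS⟩⟩
  obtain ⟨B, hB⟩ := exists_eq_ciSup_of_finite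
    (f := fun A : {A : Finset (ℤ × ℤ) // IsPathSet u v A ∧ (A : Set (ℤ × ℤ)) ⊆ S} =>
      ∑ w ∈ A.1, |ξ w|)
  exact ⟨B.1, B.2.1, B.2.2, hB⟩

theorem exists_eq_passage_univ (h₁ : u.1 ≤ v.1) (h₂ : u.2 ≤ v.2) (ξ : ℤ × ℤ → ℝ) :
    ∃ B, IsPathSet u v B ∧ ∑ w ∈ B, |ξ w| = passage univ u v ξ := by
  obtain ⟨A, hA⟩ := IsPathSet.exists_of_le h₁ h₂
  obtain ⟨B, hB, -, h⟩ := exists_eq_passage hA (subset_univ _) ξ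
  exact ⟨B, hB, h⟩

theorem measurable_passage (S : Set (ℤ × ℤ)) (u v : ℤ × ℤ) : Measurable (passage S u v) := by
  unfold passage
  refine Measurable.iSup fun A => ?_
  fun_prop

theorem dependsOn_passage (S : Set (ℤ × ℤ)) (u v : ℤ × ℤ) :
    DependsOn (passage S u v) ((Finset.Icc u v : Finset (ℤ × ℤ)) ∩ S : Set (ℤ × ℤ)) := by
  intro ξ ξ' h
  unfold passage
  refine iSup_congr fun A => Finset.sum_congr rfl fun w hw => ?_
  rw [h w ⟨A.2.1.subset_Icc hw, A.2.2 hw⟩]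

theorem passage_translate (z : ℤ × ℤ) (ξ : ℤ × ℤ → ℝ) :
    passage univ u v (fun w => ξ (w + z)) = passage univ (u + z) (v + z) ξ := by
  have key : ∀ (u v z : ℤ × ℤ) (ξ : ℤ × ℤ → ℝ),
      passage univ u v (fun w => ξ (w + z)) ≤ passage univ (u + z) (v + z) ξ := by
    intro u v z ξ
    refine Real.iSup_le (fun A => ?_) (passage_nonneg _ _ _ _)
    have := le_passage (A.2.1.translate z) (subset_univ _) ξ
    rwa [Finset.sum_image fun a _ b _ h => add_right_cancel h] at this
  refine le_antisymm (key u v z ξ) ?_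
  have := key (u + z) (v + z) (-z) (fun w => ξ (w + z))
  simpa using this

/-- Superadditivity across a diagonal step. -/
theorem passage_add_le (hu : u.1 ≤ v.1 ∧ u.2 ≤ v.2) (hw : v.1 < w.1 ∧ v.2 < w.2)
    (ξ : ℤ × ℤ → ℝ) :
    passage univ u v ξ + passage univ (v + (1, 1)) w ξ ≤ passage univ u w ξ := by
  obtain ⟨A, hA, hA'⟩ := exists_eq_passage_univ hu.1 hu.2 ξ
  obtain ⟨B, hB, hB'⟩ := exists_eq_passage_univ (u := v + (1, 1)) (v := w) (by simp; omega)
    (by simp; omega) ξ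
  rw [← hA', ← hB', ← Finset.sum_union]
  · refine le_trans (Finset.sum_le_sum_of_subset_of_nonneg ?_ fun _ _ _ => abs_nonneg _)
      (le_passage (hA.joinDiag hB) (subset_univ _) ξ)
    intro x hx
    simp only [Finset.mem_union, Finset.mem_insert] at hx ⊢
    tauto
  · rw [Finset.disjoint_left]
    intro x hx hx'
    have h1 := hA.le_right x hx
    have h2 := hB.left_le x hx'
    simp at h2
    omega

/-- The vertex `b` is counted twice on the right, which is harmless as weights are nonnegative. -/
theorem sum_le_passage_add (h : IsPathSet u v A) (hb : b ∈ A) (ξ : ℤ × ℤ → ℝ) :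
    ∑ w ∈ A, |ξ w| ≤ passage univ u b ξ + passage univ b v ξ := by
  obtain ⟨A₁, A₂, h₁, h₂, rfl⟩ := h.split hb
  have h3 := le_passage h₁ (subset_univ _) ξ
  have h4 := le_passage h₂ (subset_univ _) ξ
  have h5 := Finset.sum_union_inter (s₁ := A₁) (s₂ := A₂) (f := fun w => |ξ w|)
  have h6 : 0 ≤ ∑ w ∈ A₁ ∩ A₂, |ξ w| := Finset.sum_nonneg fun _ _ => abs_nonneg _
  linarith

/-- With `|ξ|` in its definition, `passage` is nonnegative and superadditive for every `ξ`; this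
identity confines the use of almost sure nonnegativity to the passage to and from the original
weights. -/
theorem lastPassage_eq_passage (hξ : ∀ w, 0 ≤ ξ w) :
    lastPassage u v ξ = passage univ u v ξ := by
  have hw : ∀ γ : UprightPath u v, γ.weight ξ = ∑ w ∈ γ.vertices, |ξ w| := fun γ =>
    Finset.sum_congr rfl fun w _ => (abs_of_nonneg (hξ w)).symm
  have hle : ∀ γ : UprightPath u v, γ.weight ξ ≤ passage univ u v ξ := fun γ => by
    rw [hw]; exact le_passage γ.isPathSet (subset_univ _) ξ
  refine le_antisymm (Real.iSup_le hle (passage_nonneg _ _ _ _)) ?_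
  refine Real.iSup_le (fun A => ?_) (Real.iSup_nonneg fun γ => ?_)
  · obtain ⟨γ, hγ⟩ := A.2.1.exists_path
    rw [← hγ, ← hw]
    exact le_ciSup (f := fun γ : UprightPath u v => γ.weight ξ) ⟨_, by rintro _ ⟨γ, rfl⟩; exact hle γ⟩ γ
  · rw [hw]; exact Finset.sum_nonneg fun _ _ => abs_nonneg _

end passage

/-! ### Translation invariance and independence of the environment. -/

section environment

variable (ν : Measure ℝ) [IsProbabilityMeasure ν]

instance isProbabilityMeasure_envLaw : IsProbabilityMeasure (envLaw ν) := by
  unfold envLaw; infer_instance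

theorem ae_nonneg_envLaw (hsupp : ν (Iio 0) = 0) : ∀ᵐ ξ ∂(envLaw ν), ∀ w, 0 ≤ ξ w := by
  rw [ae_all_iff]
  intro w
  have h1 : (envLaw ν).map (Function.eval w) = ν := Measure.infinitePi_map_eval _ w
  rw [ae_iff]
  have h2 : {ξ : ℤ × ℤ → ℝ | ¬ 0 ≤ ξ w} = Function.eval w ⁻¹' Iio 0 := by
    ext ξ; simp
  rw [h2, ← Measure.map_apply (measurable_pi_apply w) measurableSet_Iio, h1, hsupp]

theorem measurePreserving_translate (z : ℤ × ℤ) :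
    MeasurePreserving (fun (ξ : ℤ × ℤ → ℝ) w => ξ (w + z)) (envLaw ν) (envLaw ν) where
  measurable := by fun_prop
  map_eq := Measure.map_infinitePi_infinitePi_of_inj (P := fun _ : ℤ × ℤ => ν)
    (add_left_injective z)

theorem measureReal_passage_translate (u v z : ℤ × ℤ) {s : Set ℝ} (hs : MeasurableSet s) :
    (envLaw ν).real {ξ | passage univ (u + z) (v + z) ξ ∈ s}
      = (envLaw ν).real {ξ | passage univ u v ξ ∈ s} := by
  have h := (measurePreserving_translate ν z).measureReal_preimage
    ((measurable_passage univ u v) hs).nullMeasurableSet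
  simp only [preimage, mem_ofPred_eq, passage_translate] at h
  exact h

theorem measureReal_lastPassage (hsupp : ν (Iio 0) = 0) (u v : ℤ × ℤ) (s : Set ℝ) :
    (envLaw ν).real {ξ | lastPassage u v ξ ∈ s} = (envLaw ν).real {ξ | passage univ u v ξ ∈ s} := by
  refine measureReal_congr ?_
  filter_upwards [ae_nonneg_envLaw ν hsupp] with ξ hξ
  exact propext (by
    show lastPassage u v ξ ∈ s ↔ passage univ u v ξ ∈ s
    rw [lastPassage_eq_passage hξ])

/-- Functions of the environment on disjoint finite sets of vertices are independent. -/
theorem lintegral_prod_of_dependsOn {ι : Type*} (s : Finset ι) (f : ι → (ℤ × ℤ → ℝ) → ℝ≥0∞)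
    (B : ι → Finset (ℤ × ℤ)) (hm : ∀ i ∈ s, Measurable (f i))
    (hd : ∀ i ∈ s, DependsOn (f i) (B i))
    (hB : ∀ i ∈ s, ∀ j ∈ s, i ≠ j → Disjoint (B i) (B j)) :
    ∫⁻ ξ, ∏ i ∈ s, f i ξ ∂(envLaw ν) = ∏ i ∈ s, ∫⁻ ξ, f i ξ ∂(envLaw ν) := by
  classical
  induction s using Finset.induction_on with
  | empty => simp
  | insert a s ha ih =>
    simp only [Finset.prod_insert ha]
    rw [← ih (fun i hi => hm i (Finset.mem_insert_of_mem hi))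
      (fun i hi => hd i (Finset.mem_insert_of_mem hi))
      (fun i hi j hj => hB i (Finset.mem_insert_of_mem hi) j (Finset.mem_insert_of_mem hj))]
    have hdisj : Disjoint (B a) (s.biUnion B) := by
      rw [Finset.disjoint_biUnion_right]
      intro i hi
      exact hB a (Finset.mem_insert_self _ _) i (Finset.mem_insert_of_mem hi)
        (by rintro rfl; exact ha hi)
    have hind : ProbabilityTheory.iIndepFun (fun (w : ℤ × ℤ) (ξ : ℤ × ℤ → ℝ) => ξ w) (envLaw ν) :=
      ProbabilityTheory.iIndepFun_infinitePi (P := fun _ : ℤ × ℤ => ν) (X := fun _ x => x)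
        (fun _ => measurable_id)
    have hpair := hind.indepFun_finset (B a) (s.biUnion B) hdisj (fun i => measurable_pi_apply i)
    -- A function of the coordinates in `T` factors through the restriction to `T`: extend by zero
    -- outside.
    have key : ∀ (g : (ℤ × ℤ → ℝ) → ℝ≥0∞) (T : Finset (ℤ × ℤ)), Measurable g → DependsOn g T →
        ∃ F : (T → ℝ) → ℝ≥0∞, Measurable F ∧ ∀ ξ, g ξ = F (fun i : T => ξ i) := by
      intro g T hg hgT
      refine ⟨fun y => g (fun w => if h : w ∈ T then y ⟨w, h⟩ else 0), ?_, ?_⟩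
      · refine hg.comp (measurable_pi_lambda _ fun w => ?_)
        by_cases h : w ∈ T
        · simp only [h, dite_true]; fun_prop
        · simp only [h, dite_false]; fun_prop
      · intro ξ
        refine hgT fun w hw => ?_
        have hw' : w ∈ T := hw
        simp [hw']
    have hm' : Measurable fun ξ => ∏ i ∈ s, f i ξ :=
      Finset.measurable_prod _ fun i hi => hm i (Finset.mem_insert_of_mem hi)
    have hd' : DependsOn (fun ξ => ∏ i ∈ s, f i ξ) (s.biUnion B : Finset (ℤ × ℤ)) := by
      intro ξ ξ' h
      refine Finset.prod_congr rfl fun i hi => hd i (Finset.mem_insert_of_mem hi) fun w hw => ?_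
      exact h w (by simpa using ⟨i, hi, hw⟩)
    obtain ⟨F, hF, hF'⟩ := key _ _ (hm a (Finset.mem_insert_self _ _)) (hd a (Finset.mem_insert_self _ _))
    obtain ⟨F₂, hF₂, hF₂'⟩ := key _ _ hm' hd'
    have := ProbabilityTheory.lintegral_mul_eq_lintegral_mul_lintegral_of_indepFun
      (hm a (Finset.mem_insert_self _ _)) hm' (by
        have := hpair.comp hF hF₂
        convert this using 1
        · ext ξ; exact hF' ξ
        · ext ξ; exact hF₂' ξ)
    simpa using this

end environment

/-! ### Point-to-point tails at lengths that are powers of eight. -/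

theorem eight_pow_rpow_third (j : ℕ) : (((8 ^ j : ℕ) : ℝ)) ^ (1 / 3 : ℝ) = 2 ^ j := by
  have : (((8 ^ j : ℕ) : ℝ)) = ((2 : ℝ) ^ j) ^ (3 : ℝ) := by
    rw [show (3 : ℝ) = ((3 : ℕ) : ℝ) by norm_num, Real.rpow_natCast, ← pow_mul, mul_comm, pow_mul]
    push_cast; norm_num
  rw [this, ← Real.rpow_mul (by positivity)]
  norm_num

theorem le_rpow_three_halves {θ : ℝ} (h : 1 ≤ θ) : θ ≤ θ ^ (3 / 2 : ℝ) := by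
  conv_lhs => rw [← Real.rpow_one θ]
  exact Real.rpow_le_rpow_of_exponent_le h (by norm_num)

/-- Both tails of the point-to-point weight at length `8 ^ j` and displacement `d`, compared with
the parabola rather than with the mean. -/
theorem exists_passage_tails (ν : Measure ℝ) [IsProbabilityMeasure ν] (hsupp : ν (Iio 0) = 0)
    (h₂ : StrongConcavity ν) (h₃ : DeviationEstimates ν) :
    ∃ ρ G₁ G₂ c θ₀ : ℝ, 0 < ρ ∧ 0 < G₁ ∧ 0 < G₂ ∧ 0 < c ∧ 0 < θ₀ ∧ ∃ j₀ : ℕ, ∀ j : ℕ, j₀ ≤ j →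
      ∀ d : ℤ, |(d : ℝ)| ≤ ρ * 8 ^ j → ∀ θ : ℝ, θ₀ ≤ θ → ∀ p : ℤ × ℤ,
        (envLaw ν).real {ξ | growthRate ν * 8 ^ j - G₂ * (d : ℝ) ^ 2 / 8 ^ j + θ * 2 ^ j
            < passage univ (p + (1, 1)) (p + (8 ^ j - d, 8 ^ j + d)) ξ} ≤ Real.exp (-c * θ) ∧
        (envLaw ν).real {ξ | passage univ (p + (1, 1)) (p + (8 ^ j - d, 8 ^ j + d)) ξ
            < growthRate ν * 8 ^ j - G₁ * (d : ℝ) ^ 2 / 8 ^ j - θ * 2 ^ j} ≤ Real.exp (-c * θ) := by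
  obtain ⟨ρ, G₁, G₂, g₁, g₂, hρ, -, hG₁, hG₂, hg₁, hg₂, r₁, hmean⟩ := h₂
  obtain ⟨c, θ₀, r₂, hc, hθ₀, hr₂, hdev⟩ := h₃ (1 / 2) (by norm_num)
  obtain ⟨j₀, hj₀⟩ := exists_nat_gt (max (r₁ : ℝ) r₂)
  -- The bound `1 / 2` keeps the direction away from the axes. The threshold lets `θ` absorb the
  -- term `g₁ * 2 ^ j` of the mean: `θ - g₁ ≥ θ / 2`, whence the halved rate.
  refine ⟨min ρ (1 / 2), G₁, G₂, c / 2, 2 * (max θ₀ 1 + g₁), by positivity, hG₁, hG₂, by positivity,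
    by positivity, j₀, ?_⟩
  intro j hj d hd θ hθ p
  have h8 : (0 : ℝ) < 8 ^ j := by positivity
  have h2 : (0 : ℝ) < 2 ^ j := by positivity
  have h2' : (1 : ℝ) ≤ 2 ^ j := one_le_pow₀ (by norm_num)
  have hr : max (r₁ : ℝ) r₂ < ((8 ^ j : ℕ) : ℝ) := by
    refine hj₀.trans_le ?_
    exact_mod_cast hj.trans (Nat.lt_pow_self (by norm_num)).le
  have hm := hmean (8 ^ j) (by exact_mod_cast (lt_of_le_of_lt (le_max_left _ _) hr).le) (d / 8 ^ j)
    (by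
      rw [abs_div, abs_of_pos h8, div_le_iff₀ h8]
      exact hd.trans (mul_le_mul_of_nonneg_right (min_le_left _ _) h8.le))
  -- The mean estimate and the deviation estimate use opposite signs for the direction, hence `-(d /
  -- 8 ^ j)` here.
  have hx : |-((d : ℝ) / 8 ^ j)| ≤ 1 - 1 / 2 := by
    rw [abs_neg, abs_div, abs_of_pos h8, div_le_iff₀ h8]
    refine hd.trans (mul_le_mul_of_nonneg_right ((min_le_right _ _).trans (by norm_num)) h8.le)
  have hD := fun t => hdev _ hx (8 ^ j) (lt_of_le_of_lt (le_max_right _ _) hr) t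
  rw [eight_pow_rpow_third] at hm
  simp only [eight_pow_rpow_third] at hD
  have e1 : ((8 ^ j : ℕ) : ℝ) * (1 - (d : ℝ) / 8 ^ j) = ((8 ^ j - d : ℤ) : ℝ) := by
    push_cast; field_simp
  have e2 : ((8 ^ j : ℕ) : ℝ) * (1 + (d : ℝ) / 8 ^ j) = ((8 ^ j + d : ℤ) : ℝ) := by
    push_cast; field_simp
  have e3 : ((8 ^ j : ℕ) : ℝ) * (1 + -((d : ℝ) / 8 ^ j)) = ((8 ^ j - d : ℤ) : ℝ) := by
    push_cast; field_simp; ring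
  have e4 : ((8 ^ j : ℕ) : ℝ) * (1 - -((d : ℝ) / 8 ^ j)) = ((8 ^ j + d : ℤ) : ℝ) := by
    push_cast; field_simp; ring
  simp only [e1, e2, e3, e4] at hm hD
  set m := meanX ν ((8 ^ j - d : ℤ) : ℝ) ((8 ^ j + d : ℤ) : ℝ) with hmdef
  have hX : ∀ ξ, X ((8 ^ j - d : ℤ) : ℝ) ((8 ^ j + d : ℤ) : ℝ) ξ
      = lastPassage (1, 1) (8 ^ j - d, 8 ^ j + d) ξ := by
    intro ξ; rw [X, Int.floor_intCast, Int.floor_intCast]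
  simp only [hX] at hD
  obtain ⟨hm1, hm2⟩ := hm
  have e5 : ∀ G : ℝ, -G * ((d : ℝ) / 8 ^ j) ^ 2 * ((8 ^ j : ℕ) : ℝ) = -(G * (d : ℝ) ^ 2 / 8 ^ j) := by
    intro G; push_cast; field_simp
  rw [e5] at hm1 hm2
  push_cast at hm1 hm2
  have tr : ∀ s : Set ℝ, MeasurableSet s →
      (envLaw ν).real {ξ | passage univ (p + (1, 1)) (p + (8 ^ j - d, 8 ^ j + d)) ξ ∈ s}
      = (envLaw ν).real {ξ | lastPassage (1, 1) (8 ^ j - d, 8 ^ j + d) ξ ∈ s} := by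
    intro s hs
    rw [add_comm p, add_comm p, measureReal_passage_translate ν _ _ _ hs,
      measureReal_lastPassage ν hsupp]
  have hθ1 : 1 ≤ θ := by
    have : (1 : ℝ) ≤ max θ₀ 1 := le_max_right _ _
    linarith
  have hθg : θ / 2 ≤ θ - g₁ := by
    have : (1 : ℝ) ≤ max θ₀ 1 := le_max_right _ _
    linarith
  have hθ0 : θ₀ < θ - g₁ := by
    have : θ₀ ≤ max θ₀ 1 := le_max_left _ _
    have : (1 : ℝ) ≤ max θ₀ 1 := le_max_right _ _
    linarith
  have hθ2 : 1 ≤ θ - g₁ := by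
    have : (1 : ℝ) ≤ max θ₀ 1 := le_max_right _ _
    linarith
  constructor
  · refine le_trans (le_of_eq (tr (Ioi _) measurableSet_Ioi)) ?_
    refine le_trans (measureReal_mono ?_) ((hD θ (by linarith)).1.trans ?_)
    · intro ξ hξ
      simp only [mem_ofPred_eq, mem_Ioi] at hξ ⊢
      have : 0 < g₂ * 2 ^ j := by positivity
      linarith
    · rw [Real.exp_le_exp, neg_mul, neg_mul, neg_le_neg_iff]
      have : θ ≤ min (θ ^ (3 / 2 : ℝ)) (θ * 2 ^ j) :=
        le_min (le_rpow_three_halves hθ1) (le_mul_of_one_le_right (by linarith) h2')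
      nlinarith
  · refine le_trans (le_of_eq (tr (Iio _) measurableSet_Iio)) ?_
    refine le_trans (measureReal_mono ?_) ((hD (θ - g₁) hθ0).2.trans ?_)
    · intro ξ hξ
      simp only [mem_ofPred_eq, mem_Iio] at hξ ⊢
      linarith
    · rw [Real.exp_le_exp, neg_mul, neg_mul, neg_le_neg_iff]
      have := le_rpow_three_halves hθ2
      nlinarith

/-! ### Chaining, and simultaneous lower bounds along a diagonal. -/

/-- Chaining: for a subadditive family whose values over blocks of length `8 ^ j` have exponential
tails on the scale `2 ^ j`, so does the supremum over all starting points in such a block. -/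
theorem measureReal_exists_le_of_subadditive {Ω : Type*} [MeasurableSpace Ω] (P : Measure Ω)
    [IsProbabilityMeasure P] {f : ℤ → ℤ → Ω → ℝ} {μ c η₀ : ℝ} (hμ : 0 ≤ μ) (hc : 0 < c)
    (hη₀ : 0 < η₀) (hsub : ∀ a b d ω, a ≤ b → b ≤ d → f a d ω ≤ f a b ω + f b d ω)
    (hup : ∀ a b ω, a ≤ b → f a b ω ≤ μ * (b - a))
    (htail : ∀ (j : ℕ) (a : ℤ) (η : ℝ), η₀ ≤ η →
      P.real {ω | η * 2 ^ j < f a (a + 8 ^ j) ω} ≤ Real.exp (-c * η)) :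
    ∀ (j : ℕ) (A : ℤ) (θ : ℝ), max (max (14 * η₀) μ) (32 / (c / 14)) ≤ θ →
      P.real {ω | ∃ a, A ≤ a ∧ a ≤ A + 8 ^ j ∧ θ * 2 ^ j < f a (A + 8 ^ j) ω}
        ≤ 16 * Real.exp (-(c / 14) * θ) := by
  intro j
  induction j with
  | zero =>
    intro A θ hθ
    have hθμ : μ ≤ θ := (le_max_right _ _).trans ((le_max_left _ _).trans hθ)
    have : {ω | ∃ a, A ≤ a ∧ a ≤ A + 8 ^ 0 ∧ θ * 2 ^ 0 < f a (A + 8 ^ 0) ω} = ∅ := by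
      ext ω
      simp only [mem_ofPred_eq, mem_empty_iff_false, iff_false]
      rintro ⟨a, h1, h2, h3⟩
      have h4 := hup a (A + 8 ^ 0) ω h2
      have h5 : (((A + 8 ^ 0 : ℤ) : ℝ) - a) ≤ 1 := by
        have : A + 8 ^ 0 - a ≤ 1 := by omega
        exact_mod_cast this
      have := mul_le_mul_of_nonneg_left h5 hμ
      simp only [pow_zero] at *
      linarith
    rw [this]
    simp only [measureReal_empty]
    positivity
  | succ j ih =>
    intro A θ hθ
    have hθη : 14 * η₀ ≤ θ := (le_max_left _ _).trans ((le_max_left _ _).trans hθ)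
    have hθc : 32 / (c / 14) ≤ θ := (le_max_right _ _).trans hθ
    have hθ0 : 0 < θ := lt_of_lt_of_le (by positivity) hθc
    -- An interval ending at the right end of the big block is one partial small block followed by
    -- at most seven full ones. The budgets fit: `3/2 + 7 * (1/14) = 2`, the ratio of the two
    -- scales.
    set E : ℕ → Set Ω := fun i => {ω | ∃ a, A + i * 8 ^ j ≤ a ∧ a ≤ A + i * 8 ^ j + 8 ^ j ∧
      (3 / 2 * θ) * 2 ^ j < f a (A + i * 8 ^ j + 8 ^ j) ω} with hE
    set E' : ℕ → Set Ω := fun i => {ω | (θ / 14) * 2 ^ j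
      < f (A + i * 8 ^ j) (A + i * 8 ^ j + 8 ^ j) ω} with hE'
    have hsubset : {ω | ∃ a, A ≤ a ∧ a ≤ A + 8 ^ (j + 1) ∧ θ * 2 ^ (j + 1) < f a (A + 8 ^ (j + 1)) ω}
        ⊆ ⋃ i ∈ Finset.range 8, (E i ∪ E' i) := by
      rintro ω ⟨a, h1, h2, h3⟩
      by_contra hcon
      simp only [mem_iUnion, Finset.mem_range, mem_union, exists_prop, not_exists, not_and, not_or,
        hE, hE', mem_ofPred_eq, not_lt] at hcon
      have hchain : ∀ n : ℕ, n ≤ 8 →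
          f (A + (8 - n : ℤ) * 8 ^ j) (A + 8 ^ (j + 1)) ω ≤ n * ((θ / 14) * 2 ^ j) := by
        intro n
        induction n with
        | zero =>
          intro _
          have := hup (A + (8 - (0 : ℕ) : ℤ) * 8 ^ j) (A + 8 ^ (j + 1)) ω (by rw [pow_succ]; push_cast; linarith)
          refine this.trans (le_of_eq ?_)
          push_cast; ring
        | succ n ihn =>
          intro hn
          have h4 := ihn (by omega)
          have h5 := (hcon (8 - (n + 1)) (by omega)).2
          have e1 : A + ((8 - (n + 1) : ℕ) : ℤ) * 8 ^ j = A + (8 - (n + 1 : ℕ) : ℤ) * 8 ^ j := by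
            rw [Nat.cast_sub hn]; push_cast; ring
          have e2 : A + (8 - (n + 1 : ℕ) : ℤ) * 8 ^ j + 8 ^ j = A + (8 - n : ℤ) * 8 ^ j := by
            push_cast; ring
          rw [e1, e2] at h5
          have hp : (0 : ℤ) < 8 ^ j := by positivity
          have hn' : (n : ℤ) + 1 ≤ 8 := by exact_mod_cast hn
          have h6 := hsub (A + (8 - (n + 1 : ℕ) : ℤ) * 8 ^ j) (A + (8 - n : ℤ) * 8 ^ j)
            (A + 8 ^ (j + 1)) ω (by rw [← e2]; linarith) (by rw [pow_succ]; nlinarith)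
          push_cast at *
          linarith
      obtain ⟨i, hi8, hi1, hi2⟩ : ∃ i : ℕ, i < 8 ∧ A + i * 8 ^ j ≤ a ∧ a ≤ A + i * 8 ^ j + 8 ^ j := by
        by_contra hno
        push Not at hno
        have hgt : ∀ i : ℕ, i ≤ 8 → A + i * 8 ^ j ≤ a := by
          intro i
          induction i with
          | zero => intro _; simpa using h1
          | succ i ihi =>
            intro hi
            have := hno i (by omega) (ihi (by omega))
            push_cast
            linarith
        have h7 := hgt 7 (by omega)
        have := hno 7 (by omega) h7
        rw [pow_succ] at h2
        push_cast at this
        linarith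
      have h4 := (hcon i hi8).1 a hi1 hi2
      have h5 := hchain (7 - i) (by omega)
      have e1 : A + (8 - (7 - i : ℕ) : ℤ) * 8 ^ j = A + i * 8 ^ j + 8 ^ j := by
        rw [Nat.cast_sub (by omega)]; push_cast; ring
      rw [e1] at h5
      have hi7 : ((7 - i : ℕ) : ℝ) ≤ 7 := by exact_mod_cast Nat.sub_le 7 i
      have h6 := hsub a (A + i * 8 ^ j + 8 ^ j) (A + 8 ^ (j + 1)) ω hi2 (by
        have : (i : ℤ) + 1 ≤ 8 := by exact_mod_cast hi8
        have hp : (0 : ℤ) < 8 ^ j := by positivity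
        rw [pow_succ]; nlinarith)
      have h7 : ((7 - i : ℕ) : ℝ) * ((θ / 14) * 2 ^ j) ≤ 7 * ((θ / 14) * 2 ^ j) :=
        mul_le_mul_of_nonneg_right hi7 (by positivity)
      rw [pow_succ (2 : ℝ) j] at h3
      linarith
    have hbd : ∀ i ∈ Finset.range 8, P.real (E i ∪ E' i) ≤ 2 * Real.exp (-(c / 14) * θ) := by
      intro i _
      have h1 := ih (A + i * 8 ^ j) (3 / 2 * θ) (hθ.trans (by linarith))
      have h2 := htail j (A + i * 8 ^ j) (θ / 14) (by linarith)
      -- The partial block has threshold `3/2 * θ` in place of `θ`; the surplus decay cancels the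
      -- prefactor `16`. Each of the eight blocks then costs two exponentials, which reproduces that
      -- prefactor.
      have h3 : Real.exp (-(c / 14) * (3 / 2 * θ))
          = Real.exp (-(c / 14) * θ) * Real.exp (-((c / 14) * θ / 2)) := by
        rw [← Real.exp_add]; ring_nf
      have h4 : Real.exp (-((c / 14) * θ / 2)) ≤ 1 / 16 := by
        rw [Real.exp_neg, one_div]
        refine inv_anti₀ (by norm_num) ?_
        have h5 := Real.add_one_le_exp ((c / 14) * θ / 2)
        rw [div_le_iff₀ (by positivity)] at hθc
        linarith
      have h5 : -c * (θ / 14) = -(c / 14) * θ := by ring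
      rw [h5] at h2
      rw [h3] at h1
      have h6 := mul_le_mul_of_nonneg_left h4 (Real.exp_pos (-(c / 14) * θ)).le
      have h7 := measureReal_union_le (μ := P) (E i) (E' i)
      linarith
    refine (measureReal_mono hsubset (measure_ne_top _ _)).trans ((measureReal_biUnion_finset_le _ _).trans
      ((Finset.sum_le_sum hbd).trans (le_of_eq ?_)))
    simp; ring

/-- Along a diagonal, the weights of all the initial and of all the final pieces of a segment of
length `8 ^ j` are simultaneously bounded below on the scale `2 ^ j`. -/
theorem exists_diagonal_lower_bound (ν : Measure ℝ) [IsProbabilityMeasure ν]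
    (hsupp : ν (Iio 0) = 0) (h₂ : StrongConcavity ν) (h₃ : DeviationEstimates ν) {ε : ℝ}
    (hε : 0 < ε) :
    ∃ θ : ℝ, 0 < θ ∧ ∀ (j : ℕ) (p : ℤ × ℤ),
      (envLaw ν).real {ξ | ∃ a : ℤ, 0 ≤ a ∧ a ≤ 8 ^ j ∧
        passage univ (p + (a + 1, a + 1)) (p + (8 ^ j, 8 ^ j)) ξ
          < growthRate ν * (8 ^ j - a) - θ * 2 ^ j} ≤ ε ∧
      (envLaw ν).real {ξ | ∃ a : ℤ, 0 ≤ a ∧ a ≤ 8 ^ j ∧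
        passage univ (p + (1, 1)) (p + (a, a)) ξ < growthRate ν * a - θ * 2 ^ j} ≤ ε := by
  obtain ⟨ρ, G₁, G₂, c, θ₀, hρ, hG₁, hG₂, hc, hθ₀, j₀, htails⟩ := exists_passage_tails ν hsupp h₂ h₃
  set μ := growthRate ν with hμdef
  have hμ : 0 ≤ μ := ENNReal.toReal_nonneg
  -- The second entry makes the tail event empty for `j < j₀`, as a deficit over length `8 ^ j`
  -- never exceeds `μ * 8 ^ j`.
  set η₀ := max θ₀ (μ * 8 ^ j₀) with hη₀
  have hη₀pos : 0 < η₀ := lt_max_of_lt_left hθ₀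
  set f : ℤ × ℤ → ℤ → ℤ → (ℤ × ℤ → ℝ) → ℝ := fun p a b ξ =>
    μ * (b - a) - passage univ (p + (a + 1, a + 1)) (p + (b, b)) ξ with hf
  have hup : ∀ p a b ξ, a ≤ b → f p a b ξ ≤ μ * (b - a) := fun p a b ξ _ =>
    sub_le_self _ (passage_nonneg _ _ _ _)
  have hsub : ∀ p a b d ξ, a ≤ b → b ≤ d → f p a d ξ ≤ f p a b ξ + f p b d ξ := by
    intro p a b d ξ hab hbd
    have hnil : ∀ b, passage univ (p + (b + 1, b + 1)) (p + (b, b)) ξ = 0 := by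
      intro b
      have : IsEmpty {A : Finset (ℤ × ℤ) // IsPathSet (p + (b + 1, b + 1)) (p + (b, b)) A ∧
          (A : Set (ℤ × ℤ)) ⊆ univ} := by
        refine ⟨fun A => ?_⟩
        have := A.2.1.le_right _ A.2.1.left_mem
        simp at this
      rw [passage, Real.iSup_of_isEmpty]
    rcases hab.eq_or_lt with rfl | hab
    · simp only [hf, hnil]
      linarith
    rcases hbd.eq_or_lt with rfl | hbd
    · simp only [hf, hnil]
      linarith
    have := passage_add_le (u := p + (a + 1, a + 1)) (v := p + (b, b)) (w := p + (d, d))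
      (by simp; omega) (by simp; omega) ξ
    rw [show p + (b, b) + (1, 1) = p + (b + 1, b + 1) by ext <;> simp <;> ring] at this
    simp only [hf]
    linarith
  have htail : ∀ (p : ℤ × ℤ) (j : ℕ) (a : ℤ) (η : ℝ), η₀ ≤ η →
      (envLaw ν).real {ξ | η * 2 ^ j < f p a (a + 8 ^ j) ξ} ≤ Real.exp (-c * η) := by
    intro p j a η hη
    have h2j : (1 : ℝ) ≤ 2 ^ j := one_le_pow₀ (by norm_num)
    rcases lt_or_ge j j₀ with hj | hj
    · have : {ξ | η * 2 ^ j < f p a (a + 8 ^ j) ξ} = ∅ := by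
        ext ξ
        simp only [mem_ofPred_eq, mem_empty_iff_false, iff_false, not_lt]
        refine (hup p a (a + 8 ^ j) ξ (by simp)).trans ?_
        have h1 : (8 : ℝ) ^ j ≤ 8 ^ j₀ := pow_le_pow_right₀ (by norm_num) hj.le
        have h2 := mul_le_mul_of_nonneg_left h1 hμ
        have h3 : μ * 8 ^ j₀ ≤ η := (le_max_right _ _).trans hη
        have h4 : η ≤ η * 2 ^ j := le_mul_of_one_le_right (hη₀pos.le.trans hη) h2j
        push_cast
        linarith
      rw [this, measureReal_empty]
      exact (Real.exp_pos _).le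
    · have := (htails j hj 0 (by simp; positivity) η ((le_max_left _ _).trans hη) (p + (a, a))).2
      refine le_trans (measureReal_mono ?_) this
      intro ξ hξ
      simp only [hf, mem_ofPred_eq] at hξ ⊢
      rw [show p + (a, a) + (1, 1) = p + (a + 1, a + 1) by ext <;> simp <;> ring,
        show p + (a, a) + (8 ^ j - 0, 8 ^ j + 0) = p + (a + 8 ^ j, a + 8 ^ j) by
          ext <;> simp <;> ring]
      rw [show G₁ * ((0 : ℤ) : ℝ) ^ 2 / 8 ^ j = 0 by simp]
      push_cast at hξ ⊢
      rw [add_sub_cancel_left] at hξ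
      linarith
  have hrev : ∀ p : ℤ × ℤ, ∀ (j : ℕ) (a : ℤ) (η : ℝ), η₀ ≤ η →
      (envLaw ν).real {ξ | η * 2 ^ j < f p (-(a + 8 ^ j)) (-a) ξ} ≤ Real.exp (-c * η) := by
    intro p j a η hη
    have := htail p j (-(a + 8 ^ j)) η hη
    rwa [show -(a + 8 ^ j) + 8 ^ j = -a by ring] at this
  have H₁ := fun p => measureReal_exists_le_of_subadditive (envLaw ν) hμ hc hη₀pos (hsub p) (hup p)
    (htail p)
  -- Initial pieces become final ones under the reflection `a ↦ -a`.
  have H₂ := fun p => measureReal_exists_le_of_subadditive (envLaw ν) (f := fun a b => f p (-b) (-a))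
    hμ hc hη₀pos (fun a b d ξ hab hbd => by
      have := hsub p (-d) (-b) (-a) ξ (by omega) (by omega); linarith)
    (fun a b ξ hab => by have := hup p (-b) (-a) ξ (by omega); push_cast at this; linarith)
    (hrev p)
  obtain ⟨θ, hθ₁, hθ₂⟩ : ∃ θ : ℝ, max (max (14 * η₀) μ) (32 / (c / 14)) ≤ θ ∧
      16 * Real.exp (-(c / 14) * θ) ≤ ε := by
    have h1 : Tendsto (fun θ : ℝ => 16 * Real.exp (-(c / 14) * θ)) atTop (𝓝 (16 * 0)) :=
      (Real.tendsto_exp_atBot.comp (tendsto_id.const_mul_atTop_of_neg (by linarith))).const_mul 16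
    rw [mul_zero] at h1
    exact ((eventually_ge_atTop _).and (h1.eventually (eventually_le_nhds hε))).exists
  refine ⟨θ, lt_of_lt_of_le (by positivity) hθ₁, fun j p => ⟨?_, ?_⟩⟩
  · refine le_trans (measureReal_mono ?_) ((H₁ p j 0 θ hθ₁).trans hθ₂)
    rintro ξ ⟨a, h1, h2, h3⟩
    refine ⟨a, h1, by simpa using h2, ?_⟩
    simp only [hf, zero_add]
    push_cast
    linarith
  · refine le_trans (measureReal_mono ?_) ((H₂ p j (-8 ^ j) θ hθ₁).trans hθ₂)
    rintro ξ ⟨a, h1, h2, h3⟩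
    refine ⟨-a, by omega, by omega, ?_⟩
    simp only [hf, neg_add_cancel, neg_zero, zero_add, neg_neg]
    push_cast
    linarith

/-! ### Segments confined to diagonal strips. -/

/-- The diagonal strip `|(y - x) - (p₂ - p₁)| ≤ w` around the diagonal through `p`. -/
def strip (p : ℤ × ℤ) (w : ℤ) : Set (ℤ × ℤ) := {v | |(v.2 - v.1) - (p.2 - p.1)| ≤ w}

/-- The end point of a segment of length `8 ^ j` and displacement `d` that leaves from `p`. -/
def segEnd (p : ℤ × ℤ) (j : ℕ) (d : ℤ) : ℤ × ℤ := p + (8 ^ j - d, 8 ^ j + d)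

/-- The weight of a segment of length `8 ^ j` and displacement `d` after `p`, maximized over the
paths that stay in a strip of width of order `M * 4 ^ j`. -/
def segPassage (M : ℕ) (j : ℕ) (d : ℤ) (p : ℤ × ℤ) (ξ : ℤ × ℤ → ℝ) : ℝ :=
  passage (strip p (2 * M * 4 ^ j)) (p + (1, 1)) (segEnd p j d) ξ

/-- Backing up: the weight of the paths through a vertex `b` of the line at displacement `w` from
the diagonal through `p` is controlled by point-to-point weights with both ends fixed and by the
weights of two pieces of that line. -/
theorem passage_through_le {p : ℤ × ℤ} {t d w a : ℤ} (ha : 2 ≤ a) (hat : a < t)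
    (h₁ : 1 ≤ a - w ∧ 1 ≤ a + w) (h₂ : a - w ≤ t - d ∧ a + w ≤ t + d) (ξ : ℤ × ℤ → ℝ) :
    passage univ (p + (1, 1)) (p + (a - w, a + w)) ξ
        + passage univ (p + (a - w, a + w)) (p + (t - d, t + d)) ξ
      ≤ passage univ (p + (1, 1)) (p + (t - w, t + w)) ξ
        + passage univ (p + (-w, w) + (1, 1)) (p + (-w, w) + (t - (d - w), t + (d - w))) ξ
        - passage univ (p + (-w, w) + (a + 1, a + 1)) (p + (-w, w) + (t, t)) ξ
        - passage univ (p + (-w, w) + (1, 1)) (p + (-w, w) + (a - 1, a - 1)) ξ := by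
  have e1 : p + (-w, w) + (a + 1, a + 1) = p + (a - w, a + w) + (1, 1) := by
    ext <;> simp <;> ring
  have e2 : p + (-w, w) + (t, t) = p + (t - w, t + w) := by ext <;> simp <;> ring
  have e3 : p + (a - w, a + w) = p + (-w, w) + (a - 1, a - 1) + (1, 1) := by
    ext <;> simp <;> ring
  have e4 : p + (-w, w) + (t - (d - w), t + (d - w)) = p + (t - d, t + d) := by
    ext <;> simp <;> ring
  have h3 := passage_add_le (u := p + (1, 1)) (v := p + (a - w, a + w)) (w := p + (t - w, t + w))
    (by simp; omega) (by simp; omega) ξ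
  have h4 := passage_add_le (u := p + (-w, w) + (1, 1)) (v := p + (-w, w) + (a - 1, a - 1))
    (w := p + (t - d, t + d)) (by simp; omega) (by simp; omega) ξ
  rw [← e3] at h4
  rw [e1, e2, e4]
  linarith

/-- On the complement of nine unlikely events an unrestricted maximizer never meets the lines at
displacement `±W`, so it is itself a strip path. Four events for each line control the terms of
`passage_through_le`; the ninth is the lower tail of the segment. Only one of the two parabolic
gains is needed. -/
theorem exists_segPassage_lower_bound (ν : Measure ℝ) [IsProbabilityMeasure ν]
    (hsupp : ν (Iio 0) = 0) (h₂ : StrongConcavity ν) (h₃ : DeviationEstimates ν) {ε : ℝ}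
    (hε : 0 < ε) :
    ∃ M : ℕ, 2 ≤ M ∧ ∃ C : ℝ, 0 < C ∧ ∃ j₀ : ℕ, ∀ j : ℕ, j₀ ≤ j → ∀ d : ℤ, |d| ≤ 4 ^ j →
      ∀ p : ℤ × ℤ, (envLaw ν).real {ξ | segPassage M j d p ξ < growthRate ν * 8 ^ j - C * 2 ^ j}
        ≤ ε := by
  obtain ⟨ρ, G₁, G₂, c, θ₀, hρ, hG₁, hG₂, hc, hθ₀, j₀, htails⟩ := exists_passage_tails ν hsupp h₂ h₃
  obtain ⟨θ₂, hθ₂, hdiag⟩ := exists_diagonal_lower_bound ν hsupp h₂ h₃ (ε := ε / 9) (by positivity)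
  obtain ⟨θ₁, hθ₁, hθ₁ε⟩ : ∃ θ : ℝ, θ₀ ≤ θ ∧ Real.exp (-c * θ) ≤ ε / 9 := by
    have h1 : Tendsto (fun θ : ℝ => Real.exp (-c * θ)) atTop (𝓝 0) :=
      Real.tendsto_exp_atBot.comp (tendsto_id.const_mul_atTop_of_neg (by linarith))
    exact ((eventually_ge_atTop _).and
      (h1.eventually (eventually_le_nhds (by positivity : 0 < ε / 9)))).exists
  have hθ₁pos : 0 < θ₁ := hθ₀.trans_le hθ₁
  set μ := growthRate ν with hμdef
  have hμ : 0 ≤ μ := ENNReal.toReal_nonneg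
  -- The parabolic loss at displacement `M * 4 ^ j` is `G₂ * M ^ 2 * 2 ^ j`; it must beat all the
  -- errors collected in `key`: three point-to-point errors, two line errors, one vertex and the
  -- loss due to `d`.
  obtain ⟨M, hM⟩ := exists_nat_gt (max 2 ((3 * θ₁ + 2 * θ₂ + μ + G₁) / G₂))
  have hM2 : (2 : ℝ) < M := (le_max_left _ _).trans_lt hM
  have hMG : 3 * θ₁ + 2 * θ₂ + μ + G₁ < G₂ * (M : ℝ) ^ 2 := by
    have h1 := (le_max_right _ _).trans_lt hM
    rw [div_lt_iff₀ hG₂] at h1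
    nlinarith
  have hM2' : 2 < M := by exact_mod_cast hM2
  -- Beyond `j₁` the displacements `w` and `d - w`, at most `(M + 1) * 4 ^ j`, lie within the range
  -- `ρ * 8 ^ j` of the tail estimates.
  obtain ⟨j₁, hj₁⟩ := exists_nat_gt ((M + 1) / ρ)
  refine ⟨M, hM2'.le, θ₁ + G₁, by positivity, max (max j₀ j₁) 1, ?_⟩
  intro j hj d hd p
  have hj01 : max j₀ j₁ ≤ j := (le_max_left _ _).trans hj
  have hd' : |(d : ℝ)| ≤ 4 ^ j := by exact_mod_cast hd
  have h48 : ((M : ℝ) + 1) * 4 ^ j ≤ ρ * 8 ^ j := by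
    have h1 : (j₁ : ℝ) ≤ 2 ^ j := by
      exact_mod_cast ((le_max_right _ _).trans hj01).trans (Nat.lt_two_pow_self (n := j)).le
    rw [div_lt_iff₀ hρ] at hj₁
    have h2 : (8 : ℝ) ^ j = 2 ^ j * 4 ^ j := by rw [← mul_pow]; norm_num
    rw [h2]
    have : (M : ℝ) + 1 ≤ ρ * 2 ^ j := by nlinarith
    calc ((M : ℝ) + 1) * 4 ^ j ≤ (ρ * 2 ^ j) * 4 ^ j := by gcongr
      _ = _ := by ring
  have h4 : (1 : ℝ) ≤ 4 ^ j := one_le_pow₀ (by norm_num)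
  have h4' : (1 : ℤ) ≤ 4 ^ j := one_le_pow₀ (by norm_num)
  have h2j : (1 : ℝ) ≤ 2 ^ j := one_le_pow₀ (by norm_num)
  have h16 : ((4 : ℝ) ^ j) ^ 2 / 8 ^ j = 2 ^ j := by
    rw [div_eq_iff (by positivity), ← pow_mul, mul_comm j 2, pow_mul, ← mul_pow]; norm_num
  set W : ℤ := M * 4 ^ j with hW
  have hdW : |d| < W := by
    have : (2 : ℤ) < M := by exact_mod_cast hM2'
    nlinarith
  have hWr : (W : ℝ) = M * 4 ^ j := by rw [hW]; push_cast; ring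
  set U : ℤ → Set (ℤ × ℤ → ℝ) := fun w =>
    {ξ | μ * 8 ^ j - G₂ * (w : ℝ) ^ 2 / 8 ^ j + θ₁ * 2 ^ j
      < passage univ (p + (1, 1)) (p + (8 ^ j - w, 8 ^ j + w)) ξ} ∪
    {ξ | μ * 8 ^ j - G₂ * ((d - w : ℤ) : ℝ) ^ 2 / 8 ^ j + θ₁ * 2 ^ j
      < passage univ (p + (-w, w) + (1, 1)) (p + (-w, w) + (8 ^ j - (d - w), 8 ^ j + (d - w))) ξ} ∪
    {ξ | ∃ a : ℤ, 0 ≤ a ∧ a ≤ 8 ^ j ∧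
        passage univ (p + (-w, w) + (a + 1, a + 1)) (p + (-w, w) + (8 ^ j, 8 ^ j)) ξ
          < μ * (8 ^ j - a) - θ₂ * 2 ^ j} ∪
    {ξ | ∃ a : ℤ, 0 ≤ a ∧ a ≤ 8 ^ j ∧
        passage univ (p + (-w, w) + (1, 1)) (p + (-w, w) + (a, a)) ξ < μ * a - θ₂ * 2 ^ j} with hU
  set V : Set (ℤ × ℤ → ℝ) := {ξ | passage univ (p + (1, 1)) (p + (8 ^ j - d, 8 ^ j + d)) ξ
      < μ * 8 ^ j - G₁ * (d : ℝ) ^ 2 / 8 ^ j - θ₁ * 2 ^ j} with hV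
  have hUprob : ∀ w : ℤ, |w| = W → (envLaw ν).real (U w) ≤ 4 * (ε / 9) := by
    intro w hw
    have hwr : |(w : ℝ)| = M * 4 ^ j := by rw [← hWr]; exact_mod_cast hw
    have hj' := (le_max_left _ _).trans hj01
    have i1 := (htails j hj' w (by rw [hwr]; linarith) θ₁ hθ₁ p).1.trans hθ₁ε
    have i2 := (htails j hj' (d - w) (by
      push_cast
      refine (abs_sub _ _).trans ?_
      rw [hwr]; linarith) θ₁ hθ₁ (p + (-w, w))).1.trans hθ₁ε
    have i3 := (hdiag j (p + (-w, w))).1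
    have i4 := (hdiag j (p + (-w, w))).2
    refine (measureReal_union_le _ _).trans ?_
    refine (add_le_add_left ((measureReal_union_le _ _).trans
      (add_le_add_left (measureReal_union_le _ _) _)) _).trans ?_
    linarith
  have hVprob : (envLaw ν).real V ≤ ε / 9 :=
    (htails j ((le_max_left _ _).trans hj01) d (by
      refine hd'.trans (le_trans ?_ h48)
      nlinarith) θ₁ hθ₁ p).2.trans hθ₁ε
  have key : ∀ ξ, ξ ∉ V → ∀ w : ℤ, |w| = W → ξ ∉ U w → ∀ A : Finset (ℤ × ℤ),
      IsPathSet (p + (1, 1)) (p + (8 ^ j - d, 8 ^ j + d)) A →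
      ∑ v ∈ A, |ξ v| = passage univ (p + (1, 1)) (p + (8 ^ j - d, 8 ^ j + d)) ξ →
      ∀ b ∈ A, b.2 - b.1 ≠ p.2 - p.1 + 2 * w := by
    intro ξ hξV w hw hξU A hA hAw b hb hbw
    obtain ⟨hb1, hb2⟩ := hA.left_le b hb
    obtain ⟨hb3, hb4⟩ := hA.le_right b hb
    simp only [Prod.fst_add, Prod.snd_add] at hb1 hb2 hb3 hb4
    have hba : b = p + ((b.1 - p.1 + w) - w, (b.1 - p.1 + w) + w) := by
      ext <;> simp; linarith
    set a := b.1 - p.1 + w with ha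
    have hWd := abs_lt.1 hdW
    have haW : 2 ≤ a ∧ a < 8 ^ j := by
      rcases abs_eq (by omega : 0 ≤ W) |>.1 hw with h | h <;> omega
    have h5 := passage_through_le (p := p) (t := 8 ^ j) (d := d) (w := w) haW.1 haW.2
      ⟨by omega, by omega⟩ ⟨by omega, by omega⟩ ξ
    have h6 := sum_le_passage_add hA hb ξ
    rw [hba, hAw] at h6
    simp only [hU, hV, mem_union, mem_ofPred_eq, not_or, not_lt, not_exists, not_and] at hξU hξV
    obtain ⟨⟨⟨u1, u2⟩, u3⟩, u4⟩ := hξU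
    have u3' := u3 a (by omega) haW.2.le
    -- The vertex `b` belongs to both main pieces, so the initial line piece stops at `a - 1`. This
    -- costs one `μ`, accounted for in the choice of `M`.
    have u4' := u4 (a - 1) (by omega) (by omega)
    have hwsq : G₂ * (w : ℝ) ^ 2 / 8 ^ j = G₂ * (M : ℝ) ^ 2 * 2 ^ j := by
      have : (w : ℝ) ^ 2 = (M * 4 ^ j) ^ 2 := by
        rw [← sq_abs, ← hWr]; congr 1; exact_mod_cast hw
      rw [this, ← h16]; ring
    have hdsq : G₁ * (d : ℝ) ^ 2 / 8 ^ j ≤ G₁ * 2 ^ j := by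
      rw [← h16, mul_div_assoc]
      have : (d : ℝ) ^ 2 ≤ (4 ^ j) ^ 2 := by rw [← sq_abs]; gcongr
      gcongr
    have hpos : 0 ≤ G₂ * ((d - w : ℤ) : ℝ) ^ 2 / 8 ^ j := by positivity
    have hmain := mul_lt_mul_of_pos_right hMG (by linarith : (0 : ℝ) < 2 ^ j)
    have hμ2 : μ ≤ μ * 2 ^ j := le_mul_of_one_le_right hμ h2j
    push_cast at u4'
    nlinarith
  have hsub : {ξ | segPassage M j d p ξ < μ * 8 ^ j - (θ₁ + G₁) * 2 ^ j} ⊆ V ∪ U W ∪ U (-W) := by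
    intro ξ hξ
    by_contra hcon
    simp only [mem_union, not_or] at hcon
    obtain ⟨⟨hcV, hcW⟩, hcW'⟩ := hcon
    have h48' : (4 : ℤ) ^ j < 8 ^ j :=
      pow_lt_pow_left₀ (by norm_num) (by norm_num) (by have := (le_max_right _ _).trans hj; omega)
    have hd'' := abs_le.1 hd
    obtain ⟨A, hA, hAw⟩ := exists_eq_passage_univ (u := p + (1, 1)) (v := p + (8 ^ j - d, 8 ^ j + d))
      (by simp; omega) (by simp; omega) ξ
    have hAs : (A : Set (ℤ × ℤ)) ⊆ strip p (2 * M * 4 ^ j) := by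
      intro v hv
      by_contra hvs
      simp only [strip, mem_ofPred_eq, abs_le, not_and_or, not_le] at hvs
      rw [mul_assoc, ← hW] at hvs
      rcases hvs with hvs | hvs
      · obtain ⟨b, hb, hbw⟩ := hA.exists_diff_eq_of_ge (c := p.2 - p.1 + 2 * (-W)) (by
          simp; have := (abs_nonneg d).trans_lt hdW; omega) ⟨v, hv, by omega⟩
        exact key ξ hcV (-W) (by rw [abs_neg, abs_of_pos ((abs_nonneg d).trans_lt hdW)]) hcW' A hA
          hAw b hb hbw
      · obtain ⟨b, hb, hbw⟩ := hA.exists_diff_eq_of_le (c := p.2 - p.1 + 2 * W) (by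
          simp; have := (abs_nonneg d).trans_lt hdW; omega) ⟨v, hv, by omega⟩
        exact key ξ hcV W (abs_of_pos ((abs_nonneg d).trans_lt hdW)) hcW A hA hAw b hb hbw
    have h5 := le_passage hA hAs ξ
    rw [hAw] at h5
    simp only [hV, mem_ofPred_eq, not_lt, segPassage, segEnd] at hcV hξ
    have hdsq : G₁ * (d : ℝ) ^ 2 / 8 ^ j ≤ G₁ * 2 ^ j := by
      rw [← h16, mul_div_assoc]
      have : (d : ℝ) ^ 2 ≤ (4 ^ j) ^ 2 := by rw [← sq_abs]; gcongr
      gcongr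
    linarith
  have hWpos : 0 < W := (abs_nonneg d).trans_lt hdW
  refine (measureReal_mono hsub).trans ((measureReal_union_le _ _).trans ?_)
  have i1 := measureReal_union_le (μ := envLaw ν) V (U W)
  have i2 := hUprob W (abs_of_pos hWpos)
  have i3 := hUprob (-W) (by rw [abs_neg, abs_of_pos hWpos])
  linarith

/-! ### Concatenation, and the subdivision of a segment into eight. -/

/-- Concatenation of finitely many path sets across diagonal steps. -/
theorem IsPathSet.chain {u : ℤ × ℤ} {A₀ : Finset (ℤ × ℤ)} (P : ℕ → ℤ × ℤ)
    (A : ℕ → Finset (ℤ × ℤ)) (h₀ : IsPathSet u (P 0) A₀) :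
    ∀ N : ℕ, (∀ q < N, IsPathSet (P q + (1, 1)) (P (q + 1)) (A q)) →
      IsPathSet u (P N) (A₀ ∪ (Finset.range N).biUnion fun q => insert (P q + (1, 0)) (A q)) := by
  intro N
  induction N with
  | zero => intro _; simpa using h₀
  | succ N ih =>
    intro h
    have h1 := (ih fun q hq => h q (by omega)).joinDiag (h N (by omega))
    convert h1 using 1
    rw [Finset.range_add_one, Finset.biUnion_insert]
    ext x
    simp only [Finset.mem_union, Finset.mem_insert]
    tauto

theorem IsPathSet.exists_staircase (u : ℤ × ℤ) (n : ℕ) :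
    ∃ A, IsPathSet u (u + ((n : ℤ), (n : ℤ))) A ∧ ∀ a ∈ A, u.2 - u.1 - 1 ≤ a.2 - a.1 ∧ a.2 - a.1 ≤ u.2 - u.1 := by
  induction n with
  | zero => exact ⟨{u}, by
      rw [show u + (((0 : ℕ) : ℤ), ((0 : ℕ) : ℤ)) = u by ext <;> simp]
      exact .single, by
      simp only [Finset.mem_singleton]; rintro a rfl; omega⟩
  | succ n ih =>
    obtain ⟨A, hA, h⟩ := ih
    refine ⟨_, (hA.snoc (Or.inl rfl)).snoc (w := u + (((n + 1 : ℕ) : ℤ), ((n + 1 : ℕ) : ℤ)))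
      (Or.inr (by ext <;> simp <;> ring)), ?_⟩
    intro a ha
    simp only [Finset.mem_insert] at ha
    rcases ha with rfl | rfl | ha
    · simp
    · simp; omega
    · exact h a ha

theorem four_pow_lt_eight_pow {j : ℕ} (hj : 1 ≤ j) : (4 : ℤ) ^ j < 8 ^ j :=
  pow_lt_pow_left₀ (by norm_num) (by norm_num) (by omega)

/-- A staircase along the diagonal and then one straight leg of length `2 * |d|`. Since a strip path
exists, `segPassage` is attained by a path and is not the default value of an empty supremum. -/
theorem exists_path_in_strip {M j : ℕ} (hM : 1 ≤ M) (hj : 1 ≤ j) {d : ℤ} (hd : |d| ≤ 4 ^ j)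
    (p : ℤ × ℤ) :
    ∃ A, IsPathSet (p + (1, 1)) (segEnd p j d) A ∧
      (A : Set (ℤ × ℤ)) ⊆ strip p (2 * M * 4 ^ j) := by
  have h1 := four_pow_lt_eight_pow hj
  have h2 : (4 : ℤ) ^ j ≤ M * 4 ^ j :=
    le_mul_of_one_le_left (by positivity) (by exact_mod_cast hM)
  have h3 : (1 : ℤ) ≤ 4 ^ j := one_le_pow₀ (by norm_num)
  rw [abs_le] at hd
  rw [mul_assoc]
  rcases le_total 0 d with h0 | h0
  · obtain ⟨A, hA, hA'⟩ := IsPathSet.exists_staircase (p + (1, 1)) (8 ^ j - d - 1).toNat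
    obtain ⟨B, hB, hB'⟩ := IsPathSet.exists_vertical (p.1 + (8 ^ j - d)) (p.2 + (8 ^ j - d))
      (2 * d).toNat
    rw [Int.toNat_of_nonneg (by omega)] at hA hB
    have e1 : p + (1, 1) + (8 ^ j - d - 1, 8 ^ j - d - 1)
        = (p.1 + (8 ^ j - d), p.2 + (8 ^ j - d)) := by ext <;> simp
    have e2 : (p.1 + (8 ^ j - d), p.2 + (8 ^ j - d) + 2 * d) = segEnd p j d := by
      ext <;> simp [segEnd]; ring
    rw [e1] at hA
    rw [e2] at hB
    refine ⟨_, hA.trans hB, fun a ha => ?_⟩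
    simp only [strip, mem_ofPred_eq, abs_le]
    rcases Finset.mem_union.1 (Finset.mem_coe.1 ha) with ha | ha
    · have := hA' a ha
      simp at this
      omega
    · have h4 := hB' a ha
      have h5 := hB.left_le a ha
      have h6 := hB.le_right a ha
      simp [segEnd] at h5 h6
      omega
  · obtain ⟨A, hA, hA'⟩ := IsPathSet.exists_staircase (p + (1, 1)) (8 ^ j + d - 1).toNat
    obtain ⟨B, hB, hB'⟩ := IsPathSet.exists_horizontal (p.1 + (8 ^ j + d)) (p.2 + (8 ^ j + d))
      (-2 * d).toNat
    rw [Int.toNat_of_nonneg (by omega)] at hA hB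
    have e1 : p + (1, 1) + (8 ^ j + d - 1, 8 ^ j + d - 1)
        = (p.1 + (8 ^ j + d), p.2 + (8 ^ j + d)) := by ext <;> simp
    have e2 : (p.1 + (8 ^ j + d) + -2 * d, p.2 + (8 ^ j + d)) = segEnd p j d := by
      ext <;> simp [segEnd]; ring
    rw [e1] at hA
    rw [e2] at hB
    refine ⟨_, hA.trans hB, fun a ha => ?_⟩
    simp only [strip, mem_ofPred_eq, abs_le]
    rcases Finset.mem_union.1 (Finset.mem_coe.1 ha) with ha | ha
    · have := hA' a ha
      simp at this
      omega
    · have h4 := hB' a ha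
      have h5 := hB.left_le a ha
      have h6 := hB.le_right a ha
      simp [segEnd] at h5 h6
      omega

theorem exists_eq_segPassage {M j : ℕ} (hM : 1 ≤ M) (hj : 1 ≤ j) {d : ℤ} (hd : |d| ≤ 4 ^ j)
    (p : ℤ × ℤ) (ξ : ℤ × ℤ → ℝ) :
    ∃ A, IsPathSet (p + (1, 1)) (segEnd p j d) A ∧
      (A : Set (ℤ × ℤ)) ⊆ strip p (2 * M * 4 ^ j) ∧ ∑ v ∈ A, |ξ v| = segPassage M j d p ξ := by
  obtain ⟨A, hA, hA'⟩ := exists_path_in_strip hM hj hd p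
  exact exists_eq_passage hA hA' ξ

/-- The vertices that a strip segment can use. -/
def segBox (M j : ℕ) (d : ℤ) (p : ℤ × ℤ) : Finset (ℤ × ℤ) :=
  (Finset.Icc (p + (1, 1)) (segEnd p j d)).filter
    fun v => |(v.2 - v.1) - (p.2 - p.1)| ≤ 2 * M * 4 ^ j

theorem dependsOn_segPassage (M j : ℕ) (d : ℤ) (p : ℤ × ℤ) :
    DependsOn (segPassage M j d p) (segBox M j d p) := by
  have := dependsOn_passage (strip p (2 * M * 4 ^ j)) (p + (1, 1)) (segEnd p j d)
  have h : (segBox M j d p : Set (ℤ × ℤ))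
      = (Finset.Icc (p + (1, 1)) (segEnd p j d) : Set (ℤ × ℤ)) ∩ strip p (2 * M * 4 ^ j) := by
    ext v
    simp [segBox, strip]
  rwa [h]

theorem measurable_segPassage (M j : ℕ) (d : ℤ) (p : ℤ × ℤ) : Measurable (segPassage M j d p) :=
  measurable_passage _ _ _

theorem IsPathSet.subset_segBox {M j : ℕ} {d : ℤ} {p : ℤ × ℤ} {A : Finset (ℤ × ℤ)}
    (hA : IsPathSet (p + (1, 1)) (segEnd p j d) A)
    (hA' : (A : Set (ℤ × ℤ)) ⊆ strip p (2 * M * 4 ^ j)) : A ⊆ segBox M j d p := by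
  intro v hv
  rw [segBox, Finset.mem_filter]
  exact ⟨hA.subset_Icc hv, hA' hv⟩

/-- The `i`-th of nine points that cut a segment into eight. -/
def subPoint (p : ℤ × ℤ) (j : ℕ) (d : ℤ) (i : ℕ) : ℤ × ℤ :=
  p + (8 ^ j * i - d * i / 8, 8 ^ j * i + d * i / 8)

/-- The displacement of the `i`-th of eight pieces of a segment. -/
def subDisp (d : ℤ) (i : ℕ) : ℤ := d * (i + 1 : ℕ) / 8 - d * i / 8

theorem subPoint_succ (p : ℤ × ℤ) (j : ℕ) (d : ℤ) (i : ℕ) :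
    subPoint p j d (i + 1) = segEnd (subPoint p j d i) j (subDisp d i) := by
  ext <;> simp [subPoint, segEnd, subDisp] <;> ring

/-- An eighth of `d` is at most `4 ^ j / 2`; for `j ≥ 1` the other half leaves room for rounding. -/
theorem abs_subDisp_le {d : ℤ} {j : ℕ} (hj : 1 ≤ j) (hd : |d| ≤ 4 ^ (j + 1)) (i : ℕ) :
    |subDisp d i| ≤ 4 ^ j := by
  have h1 : (4 : ℤ) ^ 1 ≤ 4 ^ j := pow_le_pow_right₀ (by norm_num) hj
  rw [subDisp, Nat.cast_succ, mul_add, mul_one]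
  rw [pow_succ, abs_le] at hd
  rw [abs_le]
  omega

theorem subPoint_mono {p : ℤ × ℤ} {j : ℕ} (hj : 1 ≤ j) {d : ℤ} (hd : |d| ≤ 4 ^ (j + 1)) {i i' : ℕ}
    (h : i ≤ i') : (subPoint p j d i).1 ≤ (subPoint p j d i').1 := by
  induction i', h using Nat.le_induction with
  | base => exact le_rfl
  | succ n _ ih =>
    refine ih.trans ?_
    have h1 := four_pow_lt_eight_pow hj
    have h2 := abs_le.1 (abs_subDisp_le hj hd n)
    rw [subPoint_succ]
    simp only [segEnd, Prod.fst_add]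
    omega

/-- Each piece starts one diagonal step beyond the end of the previous one, and first coordinates
increase because `4 ^ j < 8 ^ j`. -/
theorem segBox_subPoint_disjoint {p : ℤ × ℤ} {M j : ℕ} (hj : 1 ≤ j) {d : ℤ}
    (hd : |d| ≤ 4 ^ (j + 1)) {i i' : ℕ} (h : i ≠ i') :
    Disjoint (segBox M j (subDisp d i) (subPoint p j d i))
      (segBox M j (subDisp d i') (subPoint p j d i')) := by
  wlog hlt : i < i' generalizing i i'
  · exact (this h.symm (by omega)).symm
  rw [Finset.disjoint_left]
  intro v hv hv'
  rw [segBox, Finset.mem_filter, Finset.mem_Icc] at hv hv'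
  have h1 := hv.1.2.1
  have h2 := hv'.1.1.1
  rw [← subPoint_succ] at h1
  have h3 := subPoint_mono (p := p) hj hd (show i + 1 ≤ i' from hlt)
  simp at h2
  omega

/-- Joining the eight optimal pieces gives a competitor for the long segment. Its vertices deviate
by at most the sum of the shift `8 * 4 ^ j` of the intermediate points and the narrow half-width `2
* M * 4 ^ j`; as `M ≥ 2`, this is within the wide half-width `8 * M * 4 ^ j`. -/
theorem sum_segPassage_le {M j : ℕ} (hM : 2 ≤ M) (hj : 1 ≤ j) {d : ℤ} (hd : |d| ≤ 4 ^ (j + 1))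
    (p : ℤ × ℤ) (ξ : ℤ × ℤ → ℝ) :
    ∑ i ∈ Finset.range 8, segPassage M j (subDisp d i) (subPoint p j d i) ξ
      ≤ segPassage M (j + 1) d p ξ := by
  choose A hA hA' hAw using fun i => exists_eq_segPassage (M := M) (by omega) hj
    (abs_subDisp_le hj hd i) (subPoint p j d i) ξ
  have h0 : subPoint p j d 0 = p := by ext <;> simp [subPoint]
  have h8 : subPoint p j d 8 = segEnd p (j + 1) d := by
    ext <;> simp [subPoint, segEnd, pow_succ]
  simp only [← subPoint_succ] at hA
  have hpath := IsPathSet.chain (fun q => subPoint p j d (q + 1)) (fun q => A (q + 1)) (hA 0) 7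
    (fun q _ => hA (q + 1))
  simp only [h0] at hpath
  rw [show 7 + 1 = 8 from rfl, h8] at hpath
  have hsub : (Finset.range 8).biUnion A ⊆ A 0 ∪ (Finset.range 7).biUnion
      fun q => insert (subPoint p j d (q + 1) + (1, 0)) (A (q + 1)) := by
    intro x hx
    simp only [Finset.mem_biUnion, Finset.mem_range, Finset.mem_union, Finset.mem_insert] at hx ⊢
    obtain ⟨i, hi, hx⟩ := hx
    rcases i with _ | i
    · exact Or.inl hx
    · exact Or.inr ⟨i, by omega, Or.inr hx⟩
  have hdisj : (↑(Finset.range 8) : Set ℕ).PairwiseDisjoint A := by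
    intro i _ i' _ hne
    refine Disjoint.mono ?_ ?_ (segBox_subPoint_disjoint (p := p) (M := M) hj hd hne)
    · exact IsPathSet.subset_segBox (by rw [← subPoint_succ]; exact hA i) (hA' i)
    · exact IsPathSet.subset_segBox (by rw [← subPoint_succ]; exact hA i') (hA' i')
  have h4 : (1 : ℤ) ≤ 4 ^ j := one_le_pow₀ (by norm_num)
  have hM4 : (2 : ℤ) * 4 ^ j ≤ M * 4 ^ j :=
    mul_le_mul_of_nonneg_right (by exact_mod_cast hM) (by positivity)
  have hdisp : ∀ i : ℕ, i ≤ 8 → |d * i / 8| ≤ 4 * 4 ^ j := by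
    intro i hi
    rw [pow_succ, abs_le] at hd
    have hi' : (i : ℤ) ≤ 8 := by exact_mod_cast hi
    have hi0 : (0 : ℤ) ≤ i := by positivity
    have h5 : d * i ≤ 8 * (4 * 4 ^ j) := by nlinarith
    have h6 : -(8 * (4 * 4 ^ j)) ≤ d * i := by nlinarith
    rw [abs_le]
    omega
  have hstrip : ∀ i : ℕ, i ≤ 8 → ∀ v : ℤ × ℤ, |(v.2 - v.1) - ((subPoint p j d i).2
      - (subPoint p j d i).1)| ≤ 2 * M * 4 ^ j → v ∈ strip p (2 * M * 4 ^ (j + 1)) := by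
    intro i hi v hv
    have h5 := abs_le.1 (hdisp i hi)
    simp only [strip, mem_ofPred_eq]
    simp only [subPoint, Prod.fst_add, Prod.snd_add] at hv
    rw [show 2 * (M : ℤ) * 4 ^ (j + 1) = 8 * (M * 4 ^ j) by ring, abs_le]
    rw [mul_assoc, abs_le] at hv
    omega
  have hB : ((A 0 ∪ (Finset.range 7).biUnion
      fun q => insert (subPoint p j d (q + 1) + (1, 0)) (A (q + 1)) : Finset (ℤ × ℤ)) :
        Set (ℤ × ℤ)) ⊆ strip p (2 * M * 4 ^ (j + 1)) := by
    intro x hx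
    simp only [Finset.coe_union, mem_union, Finset.mem_coe, Finset.mem_biUnion, Finset.mem_range,
      Finset.mem_insert] at hx
    rcases hx with hx | ⟨q, hq, rfl | hx⟩
    · exact hstrip 0 (by omega) x (hA' 0 hx)
    · refine hstrip (q + 1) (by omega) _ ?_
      simp only [Prod.fst_add, Prod.snd_add]
      rw [mul_assoc, abs_le]
      omega
    · exact hstrip (q + 1) (by omega) x (hA' (q + 1) hx)
  calc ∑ i ∈ Finset.range 8, segPassage M j (subDisp d i) (subPoint p j d i) ξ
      = ∑ v ∈ (Finset.range 8).biUnion A, |ξ v| := by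
        rw [Finset.sum_biUnion hdisj]
        exact Finset.sum_congr rfl fun i _ => (hAw i).symm
    _ ≤ _ := Finset.sum_le_sum_of_subset_of_nonneg hsub fun _ _ _ => abs_nonneg _
    _ ≤ _ := le_passage hpath hB ξ

/-! ### Exponential moments and the Chernoff bound. -/

/-- The rescaled deficit of a strip segment has a uniformly bounded exponential moment. -/
theorem exists_exponential_moment (ν : Measure ℝ) [IsProbabilityMeasure ν]
    (hsupp : ν (Iio 0) = 0) (h₂ : StrongConcavity ν) (h₃ : DeviationEstimates ν) :
    ∃ M : ℕ, 2 ≤ M ∧ ∃ κ : ℝ, 0 < κ ∧ ∀ j : ℕ, 1 ≤ j → ∀ d : ℤ, |d| ≤ 4 ^ j → ∀ p : ℤ × ℤ,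
      ∫⁻ ξ, ENNReal.ofReal (Real.exp (κ * ((growthRate ν * 8 ^ j - segPassage M j d p ξ) / 2 ^ j)))
        ∂(envLaw ν) ≤ 2 := by
  obtain ⟨M, hM, C, hC, j₀, hlow⟩ :=
    exists_segPassage_lower_bound ν hsupp h₂ h₃ (ε := 1 / 1024) (by norm_num)
  set μ := growthRate ν with hμdef
  have hμ : 0 ≤ μ := ENNReal.toReal_nonneg
  have hlog : 0 < Real.log (3 / 2) := Real.log_pos (by norm_num)
  set j₁ := j₀ + 1 with hj₁
  -- With this `κ` the exponential is at most `3 / 2` both at levels up to `j₁`, where the rescaled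
  -- deficit is at most `μ * 4 ^ j₁`, and off the bad event at higher levels, where it is at most
  -- `C`.
  set κ := Real.log (3 / 2) / (C + μ * 4 ^ j₁) with hκ
  have hden : 0 < C + μ * 4 ^ j₁ := by positivity
  have hκpos : 0 < κ := by positivity
  have hκeq : κ * (C + μ * 4 ^ j₁) = Real.log (3 / 2) := div_mul_cancel₀ _ hden.ne'
  have hexp : ∀ x, x ≤ C + μ * 4 ^ j₁ → Real.exp (κ * x) ≤ 3 / 2 := by
    intro x hx
    rw [← Real.exp_log (show (0 : ℝ) < 3 / 2 by norm_num), ← hκeq]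
    exact Real.exp_le_exp.2 (mul_le_mul_of_nonneg_left hx hκpos.le)
  have h84 : ∀ j : ℕ, (8 : ℝ) ^ j / 2 ^ j = 4 ^ j := by
    intro j; rw [← div_pow]; norm_num
  refine ⟨M, hM, κ, hκpos, ?_⟩
  intro j hj
  induction j, hj using Nat.le_induction with
  | base =>
    intro d hd p
    refine (lintegral_mono (g := fun _ => ENNReal.ofReal (3 / 2)) fun ξ => ?_).trans ?_
    · refine ENNReal.ofReal_le_ofReal (hexp _ ?_)
      have h1 : (growthRate ν * 8 ^ 1 - segPassage M 1 d p ξ) / 2 ^ 1 ≤ μ * 4 ^ 1 := by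
        rw [← h84, ← mul_div_assoc]
        gcongr
        exact sub_le_self _ (passage_nonneg _ _ _ _)
      have h2 : (4 : ℝ) ^ 1 ≤ 4 ^ j₁ := pow_le_pow_right₀ (by norm_num) (by omega)
      nlinarith
    · simp only [lintegral_const, measure_univ, mul_one]
      rw [ENNReal.ofReal_le_iff_le_toReal (by simp)]
      norm_num
  | succ j hj ih =>
    intro d hd p
    rcases le_or_gt (j + 1) j₁ with hjj | hjj
    · refine (lintegral_mono (g := fun _ => ENNReal.ofReal (3 / 2)) fun ξ => ?_).trans ?_
      · refine ENNReal.ofReal_le_ofReal (hexp _ ?_)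
        have h1 : (μ * 8 ^ (j + 1) - segPassage M (j + 1) d p ξ) / 2 ^ (j + 1)
            ≤ μ * 4 ^ (j + 1) := by
          rw [← h84, ← mul_div_assoc]
          gcongr
          exact sub_le_self _ (passage_nonneg _ _ _ _)
        have h2 : (4 : ℝ) ^ (j + 1) ≤ 4 ^ j₁ := pow_le_pow_right₀ (by norm_num) hjj
        nlinarith
      · simp only [lintegral_const, measure_univ, mul_one]
        rw [ENNReal.ofReal_le_iff_le_toReal (by simp)]
        norm_num
    · set E : Set (ℤ × ℤ → ℝ) := {ξ | segPassage M (j + 1) d p ξ < μ * 8 ^ (j + 1) - C * 2 ^ (j + 1)}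
        with hE
      have hEm : MeasurableSet E := measurableSet_lt (measurable_segPassage _ _ _ _) measurable_const
      have hEp : envLaw ν E ≤ ENNReal.ofReal (1 / 1024) := by
        rw [← ofReal_measureReal]
        exact ENNReal.ofReal_le_ofReal (hlow (j + 1) (by omega) d hd p)
      set Z : ℕ → (ℤ × ℤ → ℝ) → ℝ := fun i ξ =>
        (μ * 8 ^ j - segPassage M j (subDisp d i) (subPoint p j d i) ξ) / 2 ^ j with hZ
      -- On the bad event the rescaled deficit is at most half the sum of the eight smaller ones, so
      -- its exponential is at most the square root of their product; then `x ≤ 256 + x² / 1024`. In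
      -- the mean the three terms give `3/2 + 256/1024 + 2^8/1024 = 2`, which closes the induction.
      have hpt : ∀ ξ, ENNReal.ofReal (Real.exp (κ * ((μ * 8 ^ (j + 1)
            - segPassage M (j + 1) d p ξ) / 2 ^ (j + 1))))
          ≤ ENNReal.ofReal (3 / 2) + (ENNReal.ofReal 256 * E.indicator 1 ξ
            + ENNReal.ofReal (1 / 1024)
              * ∏ i ∈ Finset.range 8, ENNReal.ofReal (Real.exp (κ * Z i ξ))) := by
        intro ξ
        by_cases hξ : ξ ∈ E
        · refine le_trans ?_ le_add_self
          rw [indicator_of_mem hξ, Pi.one_apply, mul_one,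
            ← ENNReal.ofReal_prod_of_nonneg fun i _ => (Real.exp_pos _).le, ← Real.exp_sum,
            ← Finset.mul_sum, ← ENNReal.ofReal_mul (by norm_num),
            ← ENNReal.ofReal_add (by norm_num) (by positivity)]
          refine ENNReal.ofReal_le_ofReal ?_
          have h1 : (μ * 8 ^ (j + 1) - segPassage M (j + 1) d p ξ) / 2 ^ (j + 1)
              ≤ 1 / 2 * ∑ i ∈ Finset.range 8, Z i ξ := by
            have h2 := sum_segPassage_le hM hj hd p ξ
            simp only [hZ]
            rw [← Finset.sum_div, Finset.sum_sub_distrib, pow_succ (2 : ℝ), div_le_iff₀ (by positivity)]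
            simp only [Finset.sum_const, Finset.card_range, nsmul_eq_mul]
            have h3 : (2 : ℝ) ^ j ≠ 0 := by positivity
            field_simp
            rw [pow_succ (8 : ℝ)]
            push_cast
            linarith
          have h2 : Real.exp (κ * ∑ i ∈ Finset.range 8, Z i ξ)
              = Real.exp (κ * (1 / 2 * ∑ i ∈ Finset.range 8, Z i ξ)) ^ 2 := by
            rw [← Real.exp_nat_mul]; push_cast; ring_nf
          have h3 : Real.exp (κ * ((μ * 8 ^ (j + 1) - segPassage M (j + 1) d p ξ) / 2 ^ (j + 1)))
              ≤ Real.exp (κ * (1 / 2 * ∑ i ∈ Finset.range 8, Z i ξ)) :=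
            Real.exp_le_exp.2 (mul_le_mul_of_nonneg_left h1 hκpos.le)
          rw [h2]
          nlinarith [sq_nonneg (Real.exp (κ * (1 / 2 * ∑ i ∈ Finset.range 8, Z i ξ)) / 32 - 16)]
        · refine le_trans (ENNReal.ofReal_le_ofReal (hexp _ ?_)) le_self_add
          simp only [hE, mem_ofPred_eq, not_lt] at hξ
          have h1 : (μ * 8 ^ (j + 1) - segPassage M (j + 1) d p ξ) / 2 ^ (j + 1) ≤ C := by
            rw [div_le_iff₀ (by positivity)]; linarith
          have h2 : 0 ≤ μ * 4 ^ j₁ := by positivity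
          linarith
      have hZm : ∀ i, Measurable fun ξ => ENNReal.ofReal (Real.exp (κ * Z i ξ)) := by
        intro i
        have := measurable_segPassage M j (subDisp d i) (subPoint p j d i)
        simp only [hZ]
        fun_prop
      have hprod : ∫⁻ ξ, ∏ i ∈ Finset.range 8, ENNReal.ofReal (Real.exp (κ * Z i ξ)) ∂(envLaw ν)
          ≤ 2 ^ 8 := by
        rw [lintegral_prod_of_dependsOn ν (Finset.range 8)
          (fun i ξ => ENNReal.ofReal (Real.exp (κ * Z i ξ)))
          (fun i => segBox M j (subDisp d i) (subPoint p j d i)) (fun i _ => hZm i)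
          (fun i _ ξ ξ' h => ?_) (fun i _ i' _ h => segBox_subPoint_disjoint hj hd h)]
        · refine (Finset.prod_le_prod' (g := fun _ => 2)
            fun i _ => ih _ (abs_subDisp_le hj hd i) _).trans ?_
          simp
        · simp only [hZ, dependsOn_segPassage M j (subDisp d i) (subPoint p j d i) h]
      refine (lintegral_mono hpt).trans ?_
      rw [lintegral_add_left measurable_const,
        lintegral_add_left ((measurable_one.indicator hEm).const_mul _),
        lintegral_const_mul _ (measurable_one.indicator hEm),
        lintegral_const_mul _ (Finset.measurable_prod _ fun i _ => hZm i), lintegral_indicator_one hEm]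
      simp only [lintegral_const, measure_univ, mul_one]
      calc _ ≤ ENNReal.ofReal (3 / 2) + (ENNReal.ofReal 256 * ENNReal.ofReal (1 / 1024)
            + ENNReal.ofReal (1 / 1024) * ENNReal.ofReal (2 ^ 8)) := by
            gcongr
            refine hprod.trans (le_of_eq ?_)
            rw [ENNReal.ofReal_pow (by norm_num)]; norm_num
        _ ≤ 2 := by
            rw [← ENNReal.ofReal_mul (by norm_num), ← ENNReal.ofReal_mul (by norm_num),
              ← ENNReal.ofReal_add (by norm_num) (by norm_num),
              ← ENNReal.ofReal_add (by norm_num) (by norm_num),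
              ENNReal.ofReal_le_iff_le_toReal (by simp)]
            norm_num

/-- Convexity turns a moment bound at a segment's own scale into one at the common scale `2 ^ J`:
for `t = 2 ^ ℓ / 2 ^ J` a moment at most `2` becomes `1 + t ≤ exp t`, so a short segment pays only
in proportion to its scale. -/
theorem exp_mul_le_one_add {s x : ℝ} (h0 : 0 ≤ s) (h1 : s ≤ 1) :
    Real.exp (s * x) ≤ (1 - s) + s * Real.exp x := by
  have := convexOn_exp.2 (mem_univ 0) (mem_univ x) (sub_nonneg.2 h1) h0 (by ring)
  simpa using this

/-- Chernoff bound for the total deficit of strip segments in disjoint boxes. -/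
theorem measureReal_sum_deficit_le (ν : Measure ℝ) [IsProbabilityMeasure ν] {M : ℕ} {κ μ : ℝ}
    (hκ : 0 < κ)
    (hexp : ∀ j : ℕ, 1 ≤ j → ∀ d : ℤ, |d| ≤ 4 ^ j → ∀ p : ℤ × ℤ,
      ∫⁻ ξ, ENNReal.ofReal (Real.exp (κ * ((μ * 8 ^ j - segPassage M j d p ξ) / 2 ^ j)))
        ∂(envLaw ν) ≤ 2)
    {ι : Type*} (s : Finset ι) (J : ℕ) (ℓ : ι → ℕ) (d : ι → ℤ) (p : ι → ℤ × ℤ)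
    (hℓ : ∀ i ∈ s, 1 ≤ ℓ i ∧ ℓ i ≤ J) (hd : ∀ i ∈ s, |d i| ≤ 4 ^ ℓ i)
    (hdisj : ∀ i ∈ s, ∀ i' ∈ s, i ≠ i' →
      Disjoint (segBox M (ℓ i) (d i) (p i)) (segBox M (ℓ i') (d i') (p i'))) (y : ℝ) :
    (envLaw ν).real {ξ | y ≤ ∑ i ∈ s, (μ * 8 ^ ℓ i - segPassage M (ℓ i) (d i) (p i) ξ)}
      ≤ Real.exp (-(κ * y / 2 ^ J) + ∑ i ∈ s, (2 : ℝ) ^ ℓ i / 2 ^ J) := by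
  set D : ι → (ℤ × ℤ → ℝ) → ℝ := fun i ξ => μ * 8 ^ ℓ i - segPassage M (ℓ i) (d i) (p i) ξ with hD
  set F : ι → (ℤ × ℤ → ℝ) → ℝ≥0∞ := fun i ξ => ENNReal.ofReal (Real.exp (κ * (D i ξ / 2 ^ J)))
    with hF
  have hDm : ∀ i, Measurable (D i) := fun i =>
    measurable_const.sub (measurable_segPassage M (ℓ i) (d i) (p i))
  have hFm : ∀ i, Measurable (F i) := fun i => by
    have := hDm i
    simp only [hF]
    fun_prop
  have hFint : ∀ i ∈ s, ∫⁻ ξ, F i ξ ∂(envLaw ν)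
      ≤ ENNReal.ofReal (Real.exp ((2 : ℝ) ^ ℓ i / 2 ^ J)) := by
    intro i hi
    set t : ℝ := (2 : ℝ) ^ ℓ i / 2 ^ J with ht
    have ht0 : 0 ≤ t := by positivity
    have ht1 : t ≤ 1 := by
      rw [ht, div_le_one (by positivity)]
      exact pow_le_pow_right₀ (by norm_num) (hℓ i hi).2
    have hpt : ∀ ξ, F i ξ ≤ ENNReal.ofReal (1 - t)
        + ENNReal.ofReal t * ENNReal.ofReal (Real.exp (κ * (D i ξ / 2 ^ ℓ i))) := by
      intro ξ
      rw [← ENNReal.ofReal_mul ht0, ← ENNReal.ofReal_add (by linarith) (by positivity)]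
      refine ENNReal.ofReal_le_ofReal ?_
      refine le_trans (le_of_eq ?_) (exp_mul_le_one_add ht0 ht1)
      congr 1
      rw [ht]
      field_simp
    refine (lintegral_mono hpt).trans ?_
    have hm : Measurable fun ξ => ENNReal.ofReal (Real.exp (κ * (D i ξ / 2 ^ ℓ i))) := by
      have := hDm i
      fun_prop
    rw [lintegral_add_left measurable_const, lintegral_const_mul _ hm, lintegral_const,
      measure_univ, mul_one]
    calc _ ≤ ENNReal.ofReal (1 - t) + ENNReal.ofReal t * ENNReal.ofReal 2 := by
          gcongr
          simpa using hexp (ℓ i) (hℓ i hi).1 (d i) (hd i hi) (p i)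
      _ = ENNReal.ofReal (t + 1) := by
          rw [← ENNReal.ofReal_mul ht0, ← ENNReal.ofReal_add (by linarith) (by positivity)]
          ring_nf
      _ ≤ _ := ENNReal.ofReal_le_ofReal (Real.add_one_le_exp t)
  have hprod : ∫⁻ ξ, ∏ i ∈ s, F i ξ ∂(envLaw ν)
      ≤ ENNReal.ofReal (Real.exp (∑ i ∈ s, (2 : ℝ) ^ ℓ i / 2 ^ J)) := by
    rw [lintegral_prod_of_dependsOn ν s F (fun i => segBox M (ℓ i) (d i) (p i))
      (fun i _ => hFm i) (fun i _ ξ ξ' h => by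
        simp only [hF, hD, dependsOn_segPassage M (ℓ i) (d i) (p i) h]) hdisj]
    rw [Real.exp_sum, ENNReal.ofReal_prod_of_nonneg fun i _ => (Real.exp_pos _).le]
    exact Finset.prod_le_prod' hFint
  have hmarkov := mul_meas_ge_le_lintegral (μ := envLaw ν)
    (Finset.measurable_prod s fun i _ => hFm i) (ENNReal.ofReal (Real.exp (κ * y / 2 ^ J)))
  have hset : {ξ | y ≤ ∑ i ∈ s, D i ξ}
      ⊆ {ξ | ENNReal.ofReal (Real.exp (κ * y / 2 ^ J)) ≤ ∏ i ∈ s, F i ξ} := by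
    intro ξ hξ
    simp only [mem_ofPred_eq, hF] at hξ ⊢
    rw [← ENNReal.ofReal_prod_of_nonneg fun i _ => (Real.exp_pos _).le, ← Real.exp_sum,
      ← Finset.mul_sum, ← Finset.sum_div, mul_div_assoc]
    refine ENNReal.ofReal_le_ofReal (Real.exp_le_exp.2 ?_)
    gcongr
  rw [measureReal_def]
  refine ENNReal.toReal_le_of_le_ofReal (Real.exp_pos _).le ?_
  rw [Real.exp_add, ENNReal.ofReal_mul (Real.exp_pos _).le, Real.exp_neg,
    ENNReal.ofReal_inv_of_pos (Real.exp_pos _), mul_comm, ← div_eq_mul_inv,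
    ENNReal.le_div_iff_mul_le (Or.inl (by simp [Real.exp_pos])) (Or.inl (by simp)), mul_comm]
  exact (mul_le_mul_right (measure_mono hset) _).trans (hmarkov.trans hprod)

/-! ### Schedules: growing gaps, a bulk stretch, shrinking gaps. -/

/-- A schedule of segment levels `ℓ q` and gaps `h q` for `q < N`: the gap moves from `x` to `y`,
stays between the width at the current level and the width at level `J`, and moves slowly. -/
structure IsSchedule (J H g N : ℕ) (ℓ h : ℕ → ℕ) : Prop where
  level : ∀ q < N, 1 ≤ ℓ q ∧ ℓ q ≤ J
  lower : ∀ q < N, H * 4 ^ ℓ q ≤ h q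
  upper : ∀ q ≤ N, h q ≤ H * 4 ^ J
  inc : ∀ q < N, h (q + 1) ≤ h q + 3 * g * 4 ^ ℓ q
  dec : ∀ q < N, h q ≤ h (q + 1) + 3 * g * 4 ^ ℓ q

/-- There is a schedule from gap `x` to gap `y` of total length `T` and total scale `S`. -/
def HasSchedule (J H g x y T S : ℕ) : Prop :=
  ∃ N ℓ h, IsSchedule J H g N ℓ h ∧ h 0 = x ∧ h N = y ∧
    ∑ q ∈ Finset.range N, 8 ^ ℓ q = T ∧ ∑ q ∈ Finset.range N, 2 ^ ℓ q = S

namespace HasSchedule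

variable {J H g x y z T S T' S' j : ℕ}

theorem nil (hx : x ≤ H * 4 ^ J) : HasSchedule J H g x x 0 0 :=
  ⟨0, fun _ => 0, fun _ => x, ⟨by simp, by simp, by simpa using hx, by simp, by simp⟩, by simp⟩

theorem single (hj : 1 ≤ j) (hjJ : j ≤ J) (hx : H * 4 ^ j ≤ x) (hx' : x ≤ H * 4 ^ J)
    (hy : y ≤ H * 4 ^ J) (hxy : y ≤ x + 3 * g * 4 ^ j) (hyx : x ≤ y + 3 * g * 4 ^ j) :
    HasSchedule J H g x y (8 ^ j) (2 ^ j) := by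
  refine ⟨1, fun _ => j, fun q => if q = 0 then x else y, ⟨?_, ?_, ?_, ?_, ?_⟩, by simp⟩
  · exact fun _ _ => ⟨hj, hjJ⟩
  · intro q hq
    obtain rfl : q = 0 := by omega
    simpa using hx
  · intro q _
    split_ifs <;> assumption
  · intro q hq
    obtain rfl : q = 0 := by omega
    simpa using hxy
  · intro q hq
    obtain rfl : q = 0 := by omega
    simpa using hyx

theorem trans (h₁ : HasSchedule J H g x y T S) (h₂ : HasSchedule J H g y z T' S') :
    HasSchedule J H g x z (T + T') (S + S') := by
  obtain ⟨N, ℓ, h, hs, h0, hN, hT, hS⟩ := h₁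
  obtain ⟨N', ℓ', h', hs', h0', hN', hT', hS'⟩ := h₂
  have hℓ1 : ∀ q < N, (if q < N then ℓ q else ℓ' (q - N)) = ℓ q := fun q hq => if_pos hq
  have hh1 : ∀ q ≤ N, (if q < N then h q else h' (q - N)) = h q := by
    intro q hq
    split_ifs with h1
    · rfl
    · obtain rfl : q = N := by omega
      simp [h0', hN]
  have hℓ2 : ∀ q, (if N + q < N then ℓ (N + q) else ℓ' (N + q - N)) = ℓ' q := by
    intro q; rw [if_neg (by omega), Nat.add_sub_cancel_left]
  have hh2 : ∀ q, (if N + q < N then h (N + q) else h' (N + q - N)) = h' q := by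
    intro q; rw [if_neg (by omega), Nat.add_sub_cancel_left]
  refine ⟨N + N', fun q => if q < N then ℓ q else ℓ' (q - N),
    fun q => if q < N then h q else h' (q - N), ⟨?_, ?_, ?_, ?_, ?_⟩, ?_, ?_, ?_, ?_⟩
  · intro q hq
    rcases lt_or_ge q N with h1 | h1
    · simpa only [hℓ1 q h1] using hs.level q h1
    · obtain ⟨r, rfl⟩ := Nat.exists_eq_add_of_le h1
      simpa only [hℓ2] using hs'.level r (by omega)
  · intro q hq
    rcases lt_or_ge q N with h1 | h1
    · simpa only [hℓ1 q h1, hh1 q h1.le] using hs.lower q h1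
    · obtain ⟨r, rfl⟩ := Nat.exists_eq_add_of_le h1
      simpa only [hℓ2, hh2] using hs'.lower r (by omega)
  · intro q hq
    rcases lt_or_ge q N with h1 | h1
    · simpa only [hh1 q h1.le] using hs.upper q h1.le
    · obtain ⟨r, rfl⟩ := Nat.exists_eq_add_of_le h1
      simpa only [hh2] using hs'.upper r (by omega)
  · intro q hq
    rcases lt_or_ge q N with h1 | h1
    · simpa only [hℓ1 q h1, hh1 q h1.le, hh1 (q + 1) h1] using hs.inc q h1
    · obtain ⟨r, rfl⟩ := Nat.exists_eq_add_of_le h1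
      simpa only [hℓ2, hh2, add_assoc] using hs'.inc r (by omega)
  · intro q hq
    rcases lt_or_ge q N with h1 | h1
    · simpa only [hℓ1 q h1, hh1 q h1.le, hh1 (q + 1) h1] using hs.dec q h1
    · obtain ⟨r, rfl⟩ := Nat.exists_eq_add_of_le h1
      simpa only [hℓ2, hh2, add_assoc] using hs'.dec r (by omega)
  · simpa only [hh1 0 (Nat.zero_le _)] using h0
  · simpa only [hh2] using hN'
  · rw [Finset.sum_range_add, ← hT, ← hT']
    congr 1
    · exact Finset.sum_congr rfl fun q hq => by simp only [hℓ1 q (Finset.mem_range.1 hq)]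
    · exact Finset.sum_congr rfl fun q _ => by simp only [hℓ2]
  · rw [Finset.sum_range_add, ← hS, ← hS']
    congr 1
    · exact Finset.sum_congr rfl fun q hq => by simp only [hℓ1 q (Finset.mem_range.1 hq)]
    · exact Finset.sum_congr rfl fun q _ => by simp only [hℓ2]

theorem flat (hj : 1 ≤ j) (hjJ : j ≤ J) (r : ℕ) :
    HasSchedule J H g (H * 4 ^ J) (H * 4 ^ J) (r * 8 ^ j) (r * 2 ^ j) := by
  induction r with
  | zero => simpa using nil le_rfl
  | succ r ih =>
    rw [add_mul, add_mul, one_mul, one_mul]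
    exact ih.trans (single hj hjJ (Nat.mul_le_mul_left _ (Nat.pow_le_pow_right (by norm_num) hjJ))
      le_rfl le_rfl (by omega) (by omega))

/-- Expansion of `R` in base eight: the top level takes all the segments that fit, each lower level
at most seven, so the lower scales sum to at most `7 * 2 ^ j`. Level zero is not allowed, hence a
remainder below eight. -/
theorem fill (hj : 1 ≤ j) (hjJ : j ≤ J) (R : ℕ) :
    ∃ T S, HasSchedule J H g (H * 4 ^ J) (H * 4 ^ J) T S ∧ T ≤ R ∧ R < T + 8 ∧
      S ≤ 2 ^ j * (R / 8 ^ j) + 7 * 2 ^ j := by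
  induction j, hj using Nat.le_induction generalizing R with
  | base => exact ⟨_, _, flat le_rfl hjJ (R / 8), by omega, by omega, by omega⟩
  | succ j hj ih =>
    obtain ⟨T, S, h, h1, h2, h3⟩ := ih (by omega) (R % 8 ^ (j + 1))
    refine ⟨_, _, (flat (by omega) hjJ (R / 8 ^ (j + 1))).trans h, ?_, ?_, ?_⟩
    · have := Nat.div_add_mod' R (8 ^ (j + 1)); omega
    · have := Nat.div_add_mod' R (8 ^ (j + 1)); omega
    · have h4 : R % 8 ^ (j + 1) / 8 ^ j < 8 := by
        rw [Nat.div_lt_iff_lt_mul (by positivity), mul_comm, ← pow_succ]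
        exact Nat.mod_lt _ (by positivity)
      have h5 : 2 ^ j * (R % 8 ^ (j + 1) / 8 ^ j) ≤ 2 ^ j * 7 := Nat.mul_le_mul_left _ (by omega)
      rw [mul_comm (2 ^ (j + 1))]
      rw [pow_succ 2 j]
      omega

/-- Since `4 ^ (j + 1) - 4 ^ j = 3 * 4 ^ j`, exactly `D` increments quadruple the gap and open the
next level; reversing them closes it. -/
theorem up_steps (D g : ℕ) (hj : 1 ≤ j) (hjJ : j + 1 ≤ J) {r : ℕ} (hr : r ≤ D) :
    HasSchedule J (D * g) g (D * g * 4 ^ j) (D * g * 4 ^ j + 3 * g * 4 ^ j * r)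
        (r * 8 ^ j) (r * 2 ^ j) ∧
      HasSchedule J (D * g) g (D * g * 4 ^ j + 3 * g * 4 ^ j * r) (D * g * 4 ^ j)
        (r * 8 ^ j) (r * 2 ^ j) := by
  have h4 : 4 ^ (j + 1) ≤ 4 ^ J := Nat.pow_le_pow_right (by norm_num) hjJ
  have hle : ∀ r ≤ D, D * g * 4 ^ j + 3 * g * 4 ^ j * r ≤ D * g * 4 ^ J := by
    intro r hr
    calc D * g * 4 ^ j + 3 * g * 4 ^ j * r ≤ D * g * 4 ^ j + 3 * g * 4 ^ j * D := by gcongr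
      _ = D * g * 4 ^ (j + 1) := by ring
      _ ≤ _ := by gcongr
  induction r with
  | zero =>
    simp only [mul_zero, add_zero, zero_mul]
    exact ⟨nil (by simpa using hle 0 hr), nil (by simpa using hle 0 hr)⟩
  | succ r ih =>
    obtain ⟨i1, i2⟩ := ih (by omega)
    rw [add_mul, add_mul, one_mul, one_mul]
    refine ⟨i1.trans (single hj (by omega) (by omega) (hle r (by omega)) (hle (r + 1) hr)
      (le_of_eq (by ring)) (by rw [mul_add]; omega)), ?_⟩
    rw [add_comm (r * 8 ^ j), add_comm (r * 2 ^ j)]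
    exact (single hj (by omega) (by omega) (hle (r + 1) hr) (hle r (by omega))
      (by rw [mul_add]; omega) (le_of_eq (by ring))).trans i2

/-- Each level below `j` uses `D` segments; the bounds are the geometric sums of `8 ^ i` and `2 ^
i`. -/
theorem up_down (D g : ℕ) (hj : 1 ≤ j) (hjJ : j ≤ J) :
    ∃ T S, 7 * T ≤ D * 8 ^ j ∧ S ≤ D * 2 ^ j ∧
      HasSchedule J (D * g) g (D * g * 4) (D * g * 4 ^ j) T S ∧
      HasSchedule J (D * g) g (D * g * 4 ^ j) (D * g * 4) T S := by
  induction j, hj using Nat.le_induction with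
  | base =>
    refine ⟨0, 0, by simp, by simp, ?_, ?_⟩ <;>
    · rw [pow_one]
      refine nil (Nat.mul_le_mul_left _ ?_)
      simpa using Nat.pow_le_pow_right (n := 4) (by norm_num) hjJ
  | succ j hj ih =>
    obtain ⟨T, S, h1, h2, h3, h4⟩ := ih (by omega)
    obtain ⟨h5, h6⟩ := up_steps D g hj hjJ le_rfl
    rw [show D * g * 4 ^ j + 3 * g * 4 ^ j * D = D * g * 4 ^ (j + 1) by ring] at h5 h6
    refine ⟨T + D * 8 ^ j, S + D * 2 ^ j, ?_, ?_, h3.trans h5, ?_⟩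
    · rw [pow_succ]; nlinarith
    · rw [pow_succ]; nlinarith
    · rw [add_comm T, add_comm S]
      exact h6.trans h4

end HasSchedule

/-- The hypothesis on `R` says that the climb and the descent, each of length at most `D * 8 ^ J /
7`, fit together; the rest is filled at full gap. -/
theorem exists_schedule {J D g R : ℕ} (hJ : 1 ≤ J) (hR : 2 * D * 8 ^ J ≤ 7 * R) :
    ∃ T S, HasSchedule J (D * g) g (D * g * 4) (D * g * 4) T S ∧ T ≤ R ∧ R < T + 8 ∧
      S ≤ 2 ^ J * (2 * D + 7 + R / 8 ^ J) := by
  obtain ⟨T, S, h1, h2, h3, h4⟩ := HasSchedule.up_down D g hJ le_rfl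
  have h5 : 2 * T ≤ R := by
    have : 7 * (2 * T) ≤ 7 * R := by linarith
    omega
  obtain ⟨T', S', h6, h7, h8, h9⟩ := HasSchedule.fill (H := D * g) (g := g) hJ le_rfl (R - 2 * T)
  refine ⟨_, _, (h3.trans h6).trans h4, by omega, by omega, ?_⟩
  have h10 : (R - 2 * T) / 8 ^ J ≤ R / 8 ^ J := Nat.div_le_div_right (by omega)
  have h11 := Nat.mul_le_mul_left (2 ^ J) h10
  nlinarith

/-! ### Way points of the paths and disjointness of their boxes. -/

/-- The offset below the diagonal of the `i`-th path when the gap is `x / D`. -/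
def offset (D : ℕ) (h : ℕ → ℕ) (i q : ℕ) : ℤ := ((i * h q / D : ℕ) : ℤ)

/-- The position along the diagonal at which the `q`-th segment starts. -/
def diagTime (a₀ : ℕ) (ℓ : ℕ → ℕ) (q : ℕ) : ℤ := a₀ + ∑ r ∈ Finset.range q, 8 ^ ℓ r

/-- The `q`-th way point of the `i`-th path. -/
def wayPoint (a₀ D : ℕ) (ℓ h : ℕ → ℕ) (i q : ℕ) : ℤ × ℤ :=
  (diagTime a₀ ℓ q + offset D h i q, diagTime a₀ ℓ q - offset D h i q)

/-- The displacement of the `q`-th segment of the `i`-th path. -/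
def wayDisp (D : ℕ) (h : ℕ → ℕ) (i q : ℕ) : ℤ := offset D h i q - offset D h i (q + 1)

theorem diagTime_succ (a₀ : ℕ) (ℓ : ℕ → ℕ) (q : ℕ) :
    diagTime a₀ ℓ (q + 1) = diagTime a₀ ℓ q + 8 ^ ℓ q := by
  rw [diagTime, diagTime, Finset.sum_range_succ, add_assoc]

theorem diagTime_mono (a₀ : ℕ) (ℓ : ℕ → ℕ) : Monotone (diagTime a₀ ℓ) := by
  refine monotone_nat_of_le_succ fun q => ?_
  rw [diagTime_succ]
  exact le_add_of_nonneg_right (by positivity)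

theorem wayPoint_succ (a₀ D : ℕ) (ℓ h : ℕ → ℕ) (i q : ℕ) :
    wayPoint a₀ D ℓ h i (q + 1) = segEnd (wayPoint a₀ D ℓ h i q) (ℓ q) (wayDisp D h i q) := by
  ext <;> simp [wayPoint, segEnd, wayDisp, diagTime_succ] <;> ring

theorem offset_nonneg (D : ℕ) (h : ℕ → ℕ) (i q : ℕ) : 0 ≤ offset D h i q := Int.natCast_nonneg _

section schedule

variable {J D g k N m M a₀ : ℕ} {ℓ h : ℕ → ℕ}

theorem offset_add_le (hD : 0 < D) (hs : IsSchedule J (D * g) g N ℓ h) {q : ℕ} (hq : q < N)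
    {i i' : ℕ} (hi : i < i') : offset D h i q + g * 4 ^ ℓ q ≤ offset D h i' q := by
  have h1 : i * h q + D * (g * 4 ^ ℓ q) ≤ i' * h q := by
    have := hs.lower q hq
    have h2 : (i + 1) * h q ≤ i' * h q := Nat.mul_le_mul_right _ hi
    rw [← mul_assoc]
    linarith
  have h2 := Nat.div_le_div_right (c := D) h1
  rw [Nat.add_mul_div_left _ _ hD] at h2
  unfold offset
  exact_mod_cast h2

theorem offset_le (hs : IsSchedule J (D * g) g N ℓ h) {q : ℕ} (hq : q ≤ N) (i : ℕ) :
    offset D h i q ≤ i * (g * 4 ^ J) := by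
  have h1 : i * h q ≤ D * (i * (g * 4 ^ J)) := by
    calc i * h q ≤ i * (D * g * 4 ^ J) := Nat.mul_le_mul_left _ (hs.upper q hq)
      _ = _ := by ring
  have h2 := Nat.div_le_of_le_mul h1
  unfold offset
  exact_mod_cast h2

/-- The choice `D = 4 * g * k` gives displacement at most `3/4 * 4 ^ ℓ q`, even for the outermost
path; the remaining quarter is at least one, since `ℓ q ≥ 1`, and covers the rounding. -/
theorem abs_wayDisp_le (hg : 0 < g) (hk : 0 < k) (hs : IsSchedule J (4 * g * k * g) g N ℓ h)
    {q : ℕ} (hq : q < N) {i : ℕ} (hi : i ≤ k) : |wayDisp (4 * g * k) h i q| ≤ 4 ^ ℓ q := by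
  have hD : 0 < 4 * g * k := by positivity
  obtain ⟨e, he⟩ : ∃ e, ℓ q = e + 1 := ⟨ℓ q - 1, by have := (hs.level q hq).1; omega⟩
  have key : ∀ x y : ℕ, y ≤ x + 3 * g * 4 ^ ℓ q →
      i * y / (4 * g * k) ≤ i * x / (4 * g * k) + 4 ^ ℓ q := by
    intro x y hxy
    have h1 : i * y ≤ i * x + (4 * g * k) * (3 * 4 ^ e) := by
      calc i * y ≤ i * (x + 3 * g * 4 ^ ℓ q) := Nat.mul_le_mul_left _ hxy
        _ = i * x + i * (3 * g * 4 ^ ℓ q) := by ring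
        _ ≤ i * x + k * (3 * g * 4 ^ ℓ q) := by gcongr
        _ = _ := by rw [he]; ring
    have h2 := Nat.div_le_div_right (c := 4 * g * k) h1
    rw [Nat.add_mul_div_left _ _ hD] at h2
    refine h2.trans ?_
    rw [he, pow_succ]
    omega
  have h1 := key _ _ (hs.inc q hq)
  have h2 := key _ _ (hs.dec q hq)
  zify at h1 h2
  unfold wayDisp offset
  rw [abs_le]
  push_cast at *
  constructor <;> linarith

theorem segBox_sum_bounds {j : ℕ} {d : ℤ} {p v : ℤ × ℤ} (hv : v ∈ segBox M j d p) :
    p.1 + p.2 + 2 ≤ v.1 + v.2 ∧ v.1 + v.2 ≤ p.1 + p.2 + 2 * 8 ^ j ∧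
      |(v.2 - v.1) - (p.2 - p.1)| ≤ 2 * M * 4 ^ j := by
  rw [segBox, Finset.mem_filter, Finset.mem_Icc] at hv
  obtain ⟨⟨⟨h1, h2⟩, h3, h4⟩, h5⟩ := hv
  simp [segEnd] at h1 h2 h3 h4
  exact ⟨by omega, by omega, h5⟩

/-- Segments with different `q` occupy disjoint ranges of antidiagonals. For equal `q` the centres
differ in `y - x` by at least `2 * (2 * M + 1) * 4 ^ ℓ q`, more than two half-widths `2 * M * 4 ^ ℓ
q`. -/
theorem segBox_wayPoint_disjoint (hD : 0 < D) (hs : IsSchedule J (D * (2 * M + 1)) (2 * M + 1) N ℓ h)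
    {q q' i i' : ℕ} (hq : q < N) (hq' : q' < N) (hne : (i, q) ≠ (i', q')) :
    Disjoint (segBox M (ℓ q) (wayDisp D h i q) (wayPoint a₀ D ℓ h i q))
      (segBox M (ℓ q') (wayDisp D h i' q') (wayPoint a₀ D ℓ h i' q')) := by
  rw [Finset.disjoint_left]
  intro v hv hv'
  obtain ⟨h1, h2, h3⟩ := segBox_sum_bounds hv
  obtain ⟨h1', h2', h3'⟩ := segBox_sum_bounds hv'
  simp only [wayPoint] at h1 h2 h3 h1' h2' h3'
  rcases lt_trichotomy q q' with hlt | rfl | hlt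
  · have h4 := diagTime_mono a₀ ℓ (show q + 1 ≤ q' from hlt)
    rw [diagTime_succ] at h4
    omega
  · rw [abs_le, mul_assoc] at h3 h3'
    have h4 : (0 : ℤ) < 4 ^ ℓ q := by positivity
    rcases lt_trichotomy i i' with hi | rfl | hi
    · have h5 := offset_add_le hD hs hq hi
      push_cast at h5
      rw [add_mul, mul_assoc] at h5
      omega
    · exact hne rfl
    · have h5 := offset_add_le hD hs hq hi
      push_cast at h5
      rw [add_mul, mul_assoc] at h5
      omega
  · have h4 := diagTime_mono a₀ ℓ (show q' + 1 ≤ q from hlt)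
    rw [diagTime_succ] at h4
    omega

end schedule

/-! ### Completion to disjoint paths with prescribed end points. -/

/-- Given a schedule of strip segments, the segments can be completed to disjoint paths with the
prescribed end points. -/
theorem exists_disjoint_pathSets {J k N m M n : ℕ} {ℓ h : ℕ → ℕ} (hM : 1 ≤ M)
    (hmk : m ≤ k) (hm : 1 ≤ m)
    (hs : IsSchedule J (4 * (2 * M + 1) * k * (2 * M + 1)) (2 * M + 1) N ℓ h)
    (h0 : h 0 = 4 * (2 * M + 1) * k * (2 * M + 1) * 4)
    (hN : h N = 4 * (2 * M + 1) * k * (2 * M + 1) * 4)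
    (hT : 2 * ((4 * (2 * M + 1) + 1) * m) + ∑ q ∈ Finset.range N, 8 ^ ℓ q ≤ n)
    (hT' : n < 2 * ((4 * (2 * M + 1) + 1) * m) + ∑ q ∈ Finset.range N, 8 ^ ℓ q + 8)
    (ξ : ℤ × ℤ → ℝ) :
    ∃ V : Fin m → Finset (ℤ × ℤ),
      (∀ i : Fin m, IsPathSet (1, (m : ℤ) - (i : ℕ)) ((n : ℤ), (n : ℤ) - (i : ℕ)) (V i)) ∧
      (∀ i i' : Fin m, i ≠ i' → Disjoint (V i) (V i')) ∧
      (∀ i : Fin m, ∀ v ∈ V i, |v.2 - v.1| ≤ 2 * ((4 * (2 * M + 1) + 1) * m) + 8 ∨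
        |v.2 - v.1| ≤ 2 * m * ((2 * M + 1) * 4 ^ J)) ∧
      ∀ i : Fin m, ∑ q ∈ Finset.range N, segPassage M (ℓ q) (wayDisp (4 * (2 * M + 1) * k) h i q)
        (wayPoint ((4 * (2 * M + 1) + 1) * m) (4 * (2 * M + 1) * k) ℓ h i q) ξ
          ≤ ∑ v ∈ V i, |ξ v| := by
  set g := 2 * M + 1 with hg
  set D := 4 * g * k with hDdef
  set a₀ := (4 * g + 1) * m with ha₀
  have hkpos : 0 < k := by omega
  have hD : 0 < D := by positivity
  set o : ℕ → ℕ → ℤ := offset D h with ho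
  set a : ℕ → ℤ := diagTime a₀ ℓ with hadef
  set P : ℕ → ℕ → ℤ × ℤ := wayPoint a₀ D ℓ h with hP
  have hP1 : ∀ i q, (P i q).1 = a q + o i q := fun _ _ => rfl
  have hP2 : ∀ i q, (P i q).2 = a q - o i q := fun _ _ => rfl
  have hoe : ∀ i q, h q = D * g * 4 → o i q = i * (g * 4) := by
    intro i q hq
    have : i * (D * g * 4) / D = i * (g * 4) := by
      rw [show i * (D * g * 4) = D * (i * (g * 4)) by ring, Nat.mul_div_cancel_left _ hD]
    simp only [ho, offset, hq, this]
    push_cast; ring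
  have ho0 : ∀ i, o i 0 = i * (g * 4) := fun i => hoe i 0 h0
  have hoN : ∀ i, o i N = i * (g * 4) := fun i => hoe i N hN
  have ha0 : a 0 = a₀ := by simp [hadef, diagTime]
  have haN : a N = a₀ + ∑ q ∈ Finset.range N, 8 ^ ℓ q := rfl
  have haN1 : a N + a₀ ≤ n := by rw [haN]; zify at hT; linarith
  have haN2 : (n : ℤ) < a N + a₀ + 8 := by rw [haN]; zify at hT'; linarith
  have ha₀z : (a₀ : ℤ) = m * (g * 4) + m := by rw [ha₀]; push_cast; ring
  have hamono : ∀ q, q ≤ N → a q ≤ a N := fun q hq => diagTime_mono a₀ ℓ hq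
  have hoff : ∀ i i' : ℕ, i < i' → (i : ℤ) * (g * 4) + 1 ≤ i' * (g * 4) := by
    intro i i' hi
    have h1 : (i : ℤ) + 1 ≤ i' := by exact_mod_cast hi
    have h2 : (1 : ℤ) ≤ g * 4 := by rw [hg]; push_cast; omega
    nlinarith
  have hofm : ∀ i : ℕ, i < m → (i : ℤ) * (g * 4) ≤ m * (g * 4) := by
    intro i hi
    have := hoff i m hi
    omega
  have ho0' : ∀ i : ℕ, (0 : ℤ) ≤ i * (g * 4) := fun i => by positivity
  have hpos : ∀ i : Fin m, ((i : ℕ) : ℤ) + 1 ≤ m := fun i => by exact_mod_cast i.2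
  choose A hA hA' hAw using fun (i : Fin m) (q : ℕ) (hq : q < N) =>
    exists_eq_segPassage hM (hs.level q hq).1
      (abs_wayDisp_le (by omega) hkpos hs hq (i.2.le.trans hmk)) (P i q) ξ
  -- Nested hooks: a path of larger index starts lower, turns upward one column further right for
  -- each unit of index, and ends lower. The final hooks `B` are nested in the same way.
  choose A₀ hA₀ hA₀' using fun i : Fin m => IsPathSet.exists_threeLegs (x₀ := 1)
    (y₀ := (m : ℤ) - (i : ℕ)) (x₁ := (i : ℕ) + 1) (y₁ := (P i 0).2) (x₂ := (P i 0).1) (by omega)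
    (by rw [hP2, ho0, ha0]; have := hofm i i.2; omega)
    (by rw [hP1, ho0, ha0]; have := hofm i i.2; have := ho0' i; have := hpos i; omega)
  choose B hB hB' using fun i : Fin m => IsPathSet.exists_threeLegs (x₀ := (P i N).1 + 1)
    (y₀ := (P i N).2) (x₁ := (n : ℤ) - m + 1 + (i : ℕ)) (y₁ := (n : ℤ) - (i : ℕ)) (x₂ := (n : ℤ))
    (by rw [hP1, hoN]; have := hofm i i.2; omega)
    (by rw [hP2, hoN]; have := ho0' i; have := hpos i; have := hofm i i.2; omega)
    (by have := hpos i; omega)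
  set A' : Fin m → ℕ → Finset (ℤ × ℤ) := fun i q => if hq : q < N then A i q hq else ∅ with hA'def
  have hA'eq : ∀ i q (hq : q < N), A' i q = A i q hq := fun i q hq => dif_pos hq
  have hbox : ∀ i q (hq : q < N), A i q hq ⊆ segBox M (ℓ q) (wayDisp D h i q) (P i q) :=
    fun i q hq => (hA i q hq).subset_segBox (hA' i q hq)
  set V : Fin m → Finset (ℤ × ℤ) := fun i =>
    (A₀ i ∪ (Finset.range N).biUnion fun q => insert (P i q + (1, 0)) (A' i q)) ∪ B i with hV
  -- The antidiagonal `x + y` tells the kind of a vertex: initial hook up to `2 * a 0`, connecting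
  -- vertices exactly at `2 * a q + 1`, segments from `2 * a q + 2` to `2 * a (q + 1)`, final hook
  -- from `2 * a N + 1`. Only vertices of the same kind and the same `q` can collide.
  have hVmem : ∀ i, ∀ v ∈ V i, (v ∈ A₀ i ∧ v.1 + v.2 ≤ 2 * a 0) ∨
      (∃ q < N, v.1 = a q + o i q + 1 ∧ v.2 = a q - o i q) ∨
      (∃ q < N, v ∈ segBox M (ℓ q) (wayDisp D h i q) (P i q)) ∨
      (v ∈ B i ∧ 2 * a N + 1 ≤ v.1 + v.2) := by
    intro i v hv
    simp only [hV, Finset.mem_union, Finset.mem_biUnion, Finset.mem_range, Finset.mem_insert] at hv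
    rcases hv with (hv | ⟨q, hq, rfl | hv⟩) | hv
    · have h1 := (hA₀ i).le_right v hv
      simp only [hP1, hP2] at h1
      exact Or.inl ⟨hv, by omega⟩
    · exact Or.inr (Or.inl ⟨q, hq, by simp [hP1], by simp [hP2]⟩)
    · rw [hA'eq i q hq] at hv
      exact Or.inr (Or.inr (Or.inl ⟨q, hq, hbox i q hq hv⟩))
    · have h1 := (hB i).left_le v hv
      simp only [hP1, hP2] at h1
      exact Or.inr (Or.inr (Or.inr ⟨hv, by omega⟩))
  have hboxsum : ∀ i q v, v ∈ segBox M (ℓ q) (wayDisp D h i q) (P i q) →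
      2 * a q + 2 ≤ v.1 + v.2 ∧ v.1 + v.2 ≤ 2 * a (q + 1) := by
    intro i q v hv
    obtain ⟨h1, h2, -⟩ := segBox_sum_bounds hv
    rw [hP1, hP2] at h1 h2
    have h3 : a (q + 1) = a q + 8 ^ ℓ q := diagTime_succ a₀ ℓ q
    omega
  have hsucc : ∀ q, a q + 1 ≤ a (q + 1) := by
    intro q
    have h3 : a (q + 1) = a q + 8 ^ ℓ q := diagTime_succ a₀ ℓ q
    have : (1 : ℤ) ≤ 8 ^ ℓ q := one_le_pow₀ (by norm_num)
    omega
  have hmono : ∀ {q q' : ℕ}, q ≤ q' → a q ≤ a q' := fun hq => diagTime_mono a₀ ℓ hq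
  refine ⟨V, ?_, ?_, ?_, ?_⟩
  · intro i
    have hchain := IsPathSet.chain (P i) (A' i) (hA₀ i) N (fun q hq => by
      rw [hA'eq i q hq]
      have := hA i q hq
      rwa [hP, ← wayPoint_succ] at this)
    exact hchain.join (Or.inl (by ext <;> simp)) (hB i)
  · intro i i' hne
    wlog hlt : i < i' generalizing i i'
    · exact (this i' i hne.symm (lt_of_le_of_ne (not_lt.1 hlt) hne.symm)).symm
    have hlt' : (i : ℕ) < (i' : ℕ) := hlt
    have hoo := hoff i i' hlt'
    have hoq : ∀ q < N, o i q < o i' q := by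
      intro q hq
      have h1 := offset_add_le hD hs hq hlt'
      have h2 : (0 : ℤ) < g * 4 ^ ℓ q := by positivity
      simp only [ho]
      omega
    rw [Finset.disjoint_left]
    intro v hv hv'
    rcases hVmem i v hv with ⟨hv, s1⟩ | ⟨q, hq, hv1, hv2⟩ | ⟨q, hq, hv⟩ | ⟨hv, s1⟩ <;>
    rcases hVmem i' v hv' with ⟨hv', s1'⟩ | ⟨q', hq', hv1', hv2'⟩ | ⟨q', hq', hv'⟩ | ⟨hv', s1'⟩
    · have h1 := hA₀' i v hv
      have h2 := hA₀' i' v hv'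
      simp only [hP1, hP2, ho0, ha0] at h1 h2
      have := hpos i'
      have := hofm i' i'.2
      omega
    · have := hmono (Nat.zero_le q'); omega
    · have := hboxsum i' q' v hv'; have := hmono (Nat.zero_le q'); omega
    · have := hmono (Nat.zero_le N); omega
    · have := hmono (Nat.zero_le q); omega
    · rcases lt_trichotomy q q' with h1 | rfl | h1
      · have := hmono (show q + 1 ≤ q' from h1); have := hsucc q; omega
      · have := hoq q hq; omega
      · have := hmono (show q' + 1 ≤ q from h1); have := hsucc q'; omega
    · have := hboxsum i' q' v hv'
      rcases lt_or_ge q' q with h1 | h1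
      · have := hmono (show q' + 1 ≤ q from h1); omega
      · have := hmono h1; omega
    · have := hmono (show q + 1 ≤ N from hq); have := hsucc q; omega
    · have := hboxsum i q v hv; have := hmono (Nat.zero_le q); omega
    · have := hboxsum i q v hv
      rcases lt_or_ge q q' with h1 | h1
      · have := hmono (show q + 1 ≤ q' from h1); omega
      · have := hmono h1; omega
    · exact Finset.disjoint_left.1 (segBox_wayPoint_disjoint (a₀ := a₀) hD hs hq hq'
        (by simp; omega)) hv hv'
    · have := hboxsum i q v hv; have := hmono (show q + 1 ≤ N from hq); omega
    · have := hmono (Nat.zero_le N); omega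
    · have := hmono (show q' + 1 ≤ N from hq'); have := hsucc q'; omega
    · have := hboxsum i' q' v hv'; have := hmono (show q' + 1 ≤ N from hq'); omega
    · have h1 := hB' i v hv
      have h2 := hB' i' v hv'
      simp only [hP1, hP2, hoN] at h1 h2
      have := hpos i'
      have := hofm i' i'.2
      have := ho0' i
      omega
  · intro i v hv
    have hole : ∀ q ≤ N, 2 * o i q + 2 * (g * 4 ^ J) ≤ 2 * m * (g * 4 ^ J) := by
      intro q hq
      have h1 := offset_le hs hq i
      have h2 := hpos i
      have h3 : (0 : ℤ) ≤ g * 4 ^ J := by positivity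
      have h4 : (i : ℤ) * (g * 4 ^ J) + g * 4 ^ J ≤ m * (g * 4 ^ J) := by nlinarith
      simp only [ho]
      linarith
    have hgz : ((2 : ℤ) * M + 1) = g := by rw [hg]; push_cast; ring
    have hg1 : (1 : ℤ) ≤ g := by rw [hg]; push_cast; omega
    have h4J : (1 : ℤ) ≤ 4 ^ J := one_le_pow₀ (by norm_num)
    have h4g : (1 : ℤ) ≤ g * 4 ^ J := by nlinarith
    have hon : ∀ q, 0 ≤ o i q := fun q => offset_nonneg _ _ _ _
    rcases hVmem i v hv with ⟨hv, -⟩ | ⟨q, hq, hv1, hv2⟩ | ⟨q, hq, hv⟩ | ⟨hv, -⟩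
    · left
      have h1 := hA₀' i v hv
      simp only [hP1, hP2, ho0, ha0] at h1
      have := hpos i
      have := hofm i i.2
      have := ho0' i
      have e : 2 * ((4 * (2 * (M : ℤ) + 1) + 1) * m) = 2 * a₀ := by rw [hgz, ha₀]; push_cast; ring
      rw [e, abs_le]
      omega
    · right
      rw [hgz, abs_le]
      have := hole q hq.le
      have := hon q
      omega
    · right
      obtain ⟨-, -, h3⟩ := segBox_sum_bounds hv
      rw [hP1, hP2] at h3
      have h5 : 2 * (M : ℤ) * 4 ^ ℓ q ≤ 2 * (g * 4 ^ J) := by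
        have h6 : (4 : ℤ) ^ ℓ q ≤ 4 ^ J := pow_le_pow_right₀ (by norm_num) (hs.level q hq).2
        rw [← hgz]
        nlinarith
      have := hole q hq.le
      have := hon q
      rw [abs_le] at h3
      rw [hgz, abs_le]
      omega
    · left
      have h1 := hB' i v hv
      simp only [hP1, hP2, hoN] at h1
      have := hpos i
      have := hofm i i.2
      have := ho0' i
      have e : 2 * ((4 * (2 * (M : ℤ) + 1) + 1) * m) = 2 * a₀ := by rw [hgz, ha₀]; push_cast; ring
      rw [e, abs_le]
      omega
  · intro i
    have hdisj : (↑(Finset.range N) : Set ℕ).PairwiseDisjoint (A' i) := by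
      intro q hq q' hq' hne
      have hq := Finset.mem_range.1 (Finset.mem_coe.1 hq)
      have hq' := Finset.mem_range.1 (Finset.mem_coe.1 hq')
      rw [Function.onFun, hA'eq i q hq, hA'eq i q' hq']
      exact Disjoint.mono (hbox i q hq) (hbox i q' hq')
        (segBox_wayPoint_disjoint hD hs hq hq' (by simp [hne]))
    calc _ = ∑ v ∈ (Finset.range N).biUnion (A' i), |ξ v| := by
          rw [Finset.sum_biUnion hdisj]
          refine Finset.sum_congr rfl fun q hq => ?_
          rw [hA'eq i q (Finset.mem_range.1 hq), hAw i q (Finset.mem_range.1 hq)]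
      _ ≤ _ := by
          refine Finset.sum_le_sum_of_subset_of_nonneg ?_ fun _ _ _ => abs_nonneg _
          intro v hv
          simp only [hV, Finset.mem_union, Finset.mem_biUnion, Finset.mem_range,
            Finset.mem_insert] at hv ⊢
          obtain ⟨q, hq, hv⟩ := hv
          exact Or.inl (Or.inr ⟨q, hq, Or.inr hv⟩)

/-! ### From path sets to paths, and choice of the scales. -/

theorem UprightPath.tf_le {u v : ℤ × ℤ} (γ : UprightPath u v) {T : ℝ}
    (h : ∀ w ∈ γ.vertices, |((w.2 - w.1 : ℤ) : ℝ)| ≤ T) : γ.tf ≤ T := by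
  refine ciSup_le fun i => ?_
  -- The vertical distance to the diagonal exceeds the true one by a factor `√2`, which the bound
  -- can afford.
  have hmem : (!₂[((γ.pt i).1 : ℝ), ((γ.pt i).1 : ℝ)] : EuclideanSpace ℝ (Fin 2)) ∈ diagonalLine := by
    simp [diagonalLine]
  refine (Metric.infDist_le_dist_of_mem hmem).trans ?_
  rw [EuclideanSpace.dist_eq]
  have := h (γ.pt i) (Finset.mem_image_of_mem _ (Finset.mem_univ i))
  simp only [Fin.sum_univ_two, Real.dist_eq]
  simp only [Matrix.cons_val_zero, Matrix.cons_val_one, sub_self, abs_zero]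
  rw [zero_pow two_ne_zero, zero_add, sq_abs, Real.sqrt_sq_eq_abs]
  simpa using this

theorem hasDisjointPaths_of_pathSets {n m : ℕ} {T W : ℝ} {ξ : ℤ × ℤ → ℝ} (hξ : ∀ w, 0 ≤ ξ w)
    (V : Fin m → Finset (ℤ × ℤ))
    (hV : ∀ i : Fin m, IsPathSet (1, (m : ℤ) - (i : ℕ)) ((n : ℤ), (n : ℤ) - (i : ℕ)) (V i))
    (hdisj : ∀ i i' : Fin m, i ≠ i' → Disjoint (V i) (V i'))
    (htf : ∀ i, ∀ v ∈ V i, |((v.2 - v.1 : ℤ) : ℝ)| ≤ T)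
    (hW : W ≤ ∑ i, ∑ v ∈ V i, |ξ v|) : HasDisjointPaths n m T W ξ := by
  choose γ hγ using fun i => (hV i).exists_path
  refine ⟨γ, fun i j hij => ?_, fun i w hw => ?_, fun i => ?_, ?_⟩
  · rw [hγ, hγ]; exact hdisj i j hij
  · rw [hγ] at hw
    have h1 := (hV i).left_le w hw
    have h2 := (hV i).le_right w hw
    have h3 : ((i : ℕ) : ℤ) + 1 ≤ m := by exact_mod_cast i.2
    simp only at h1 h2
    omega
  · exact (γ i).tf_le fun w hw => htf i w (by rwa [hγ] at hw)
  · refine hW.trans (le_of_eq (Finset.sum_congr rfl fun i _ => ?_))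
    rw [UprightPath.weight, hγ]
    exact Finset.sum_congr rfl fun v _ => abs_of_nonneg (hξ v)

/-- The threshold has `K + 1` where the exponential moments consume `K`; the surplus is exactly the
exponent `k * m`. -/
theorem one_sub_exp_le_measureReal_deficit (ν : Measure ℝ) [IsProbabilityMeasure ν] {M : ℕ}
    {κ μ : ℝ} (hκ : 0 < κ)
    (hexp : ∀ j : ℕ, 1 ≤ j → ∀ d : ℤ, |d| ≤ 4 ^ j → ∀ p : ℤ × ℤ,
      ∫⁻ ξ, ENNReal.ofReal (Real.exp (κ * ((μ * 8 ^ j - segPassage M j d p ξ) / 2 ^ j)))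
        ∂(envLaw ν) ≤ 2)
    {J k N m K a₀ : ℕ} {ℓ h : ℕ → ℕ} (hk : 1 ≤ k) (hmk : m ≤ k)
    (hs : IsSchedule J (4 * (2 * M + 1) * k * (2 * M + 1)) (2 * M + 1) N ℓ h)
    (hS : ∑ q ∈ Finset.range N, 2 ^ ℓ q ≤ 2 ^ J * (k * K)) :
    1 - Real.exp (-1 * k * m) ≤ (envLaw ν).real {ξ | ∑ i : Fin m, ∑ q ∈ Finset.range N,
      (μ * 8 ^ ℓ q - segPassage M (ℓ q) (wayDisp (4 * (2 * M + 1) * k) h i q)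
        (wayPoint a₀ (4 * (2 * M + 1) * k) ℓ h i q) ξ) < (K + 1) * m * k * 2 ^ J / κ} := by
  set D := 4 * (2 * M + 1) * k with hD
  set y : ℝ := (K + 1) * m * k * 2 ^ J / κ with hy
  have hmem : ∀ x : Fin m × ℕ, x ∈ (Finset.univ : Finset (Fin m)) ×ˢ Finset.range N → x.2 < N :=
    fun x hx => Finset.mem_range.1 (Finset.mem_product.1 hx).2
  have hchern := measureReal_sum_deficit_le ν hκ hexp
    ((Finset.univ : Finset (Fin m)) ×ˢ Finset.range N) J (fun x => ℓ x.2)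
    (fun x => wayDisp D h x.1 x.2) (fun x => wayPoint a₀ D ℓ h x.1 x.2)
    (fun x hx => hs.level x.2 (hmem x hx))
    (fun x hx => abs_wayDisp_le (by omega) (by omega) hs (hmem x hx) (x.1.2.le.trans hmk))
    (fun x hx x' hx' hne => segBox_wayPoint_disjoint (by positivity) hs
      (hmem x hx) (hmem x' hx') (fun heq => hne (by
        rw [Prod.mk.injEq] at heq
        exact Prod.ext (Fin.ext heq.1) heq.2))) y
  have hexpo : -(κ * y / 2 ^ J) + ∑ x ∈ (Finset.univ : Finset (Fin m)) ×ˢ Finset.range N,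
      (2 : ℝ) ^ ℓ x.2 / 2 ^ J ≤ -1 * k * m := by
    have h1 : ∑ x ∈ (Finset.univ : Finset (Fin m)) ×ˢ Finset.range N, (2 : ℝ) ^ ℓ x.2 / 2 ^ J
        ≤ m * (k * K) := by
      have h2 : ∑ q ∈ Finset.range N, (2 : ℝ) ^ ℓ q ≤ 2 ^ J * (k * K) := by exact_mod_cast hS
      rw [Finset.sum_product]
      dsimp only
      rw [Finset.sum_const, Finset.card_univ, Fintype.card_fin, nsmul_eq_mul, ← Finset.sum_div]
      refine mul_le_mul_of_nonneg_left ?_ (by positivity)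
      rw [div_le_iff₀ (by positivity)]
      linarith
    have h3 : κ * y / 2 ^ J = (K + 1) * m * k := by
      rw [hy]; field_simp
    rw [h3]
    linarith
  have hEm : MeasurableSet {ξ | y ≤ ∑ x ∈ (Finset.univ : Finset (Fin m)) ×ˢ Finset.range N,
      (μ * 8 ^ ℓ x.2 - segPassage M (ℓ x.2) (wayDisp D h x.1 x.2) (wayPoint a₀ D ℓ h x.1 x.2) ξ)} :=
    measurableSet_le measurable_const (Finset.measurable_sum _ fun x _ =>
      measurable_const.sub (measurable_segPassage _ _ _ _))
  have hc := probReal_compl_eq_one_sub (μ := envLaw ν) hEm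
  have hEp := hchern.trans (Real.exp_le_exp.2 hexpo)
  refine le_trans (by rw [hc]; linarith) (measureReal_mono (μ := envLaw ν) ?_)
  intro ξ hξ
  rw [mem_compl_iff, mem_ofPred_eq, not_le, Finset.sum_product] at hξ
  exact hξ

/-- The cube root of `n / k`, and the scales of the construction in terms of it. -/
theorem exists_cube_root {n k : ℕ} (hk : 0 < k) (hn : 0 < n) :
    ∃ δ : ℝ, 0 < δ ∧ δ ^ 3 * k = n ∧
      (k : ℝ) ^ (-2 / 3 : ℝ) * (n : ℝ) ^ (2 / 3 : ℝ) = δ ^ 2 ∧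
      (k : ℝ) ^ (2 / 3 : ℝ) * (n : ℝ) ^ (1 / 3 : ℝ) = k * δ := by
  have hk' : (0 : ℝ) < k := by exact_mod_cast hk
  have hn' : (0 : ℝ) < n := by exact_mod_cast hn
  set a := (k : ℝ) ^ (1 / 3 : ℝ) with ha
  set b := (n : ℝ) ^ (1 / 3 : ℝ) with hb
  have hapos : 0 < a := Real.rpow_pos_of_pos hk' _
  have hbpos : 0 < b := Real.rpow_pos_of_pos hn' _
  have ha3 : a ^ 3 = k := by
    rw [ha, ← Real.rpow_natCast, ← Real.rpow_mul hk'.le]; norm_num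
  have hb3 : b ^ 3 = n := by
    rw [hb, ← Real.rpow_natCast, ← Real.rpow_mul hn'.le]; norm_num
  have ha2 : (k : ℝ) ^ (2 / 3 : ℝ) = a ^ 2 := by
    rw [ha, ← Real.rpow_natCast, ← Real.rpow_mul hk'.le]; norm_num
  have hb2 : (n : ℝ) ^ (2 / 3 : ℝ) = b ^ 2 := by
    rw [hb, ← Real.rpow_natCast, ← Real.rpow_mul hn'.le]; norm_num
  have ha2' : (k : ℝ) ^ (-2 / 3 : ℝ) = (a ^ 2)⁻¹ := by
    rw [show (-2 / 3 : ℝ) = -(2 / 3) by norm_num, Real.rpow_neg hk'.le, ha2]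
  refine ⟨b / a, by positivity, ?_, ?_, ?_⟩
  · rw [← ha3, ← hb3]; field_simp
  · rw [ha2', hb2]; field_simp
  · rw [ha2, ← ha3]; field_simp

/-- A schedule for `m` paths in a square of side `n`, with about `k` segments at each level. -/
theorem exists_scaled_schedule {g n k m : ℕ} (hg5 : 5 ≤ g) (hk : 1 ≤ k) (hmk : m ≤ k)
    (hkn : 8 * ((2 * g) ^ 3 * k) ≤ n) :
    ∃ (J N : ℕ) (ℓ h : ℕ → ℕ), IsSchedule J (4 * g * k * g) g N ℓ h ∧
      h 0 = 4 * g * k * g * 4 ∧ h N = 4 * g * k * g * 4 ∧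
      2 * ((4 * g + 1) * m) + ∑ q ∈ Finset.range N, 8 ^ ℓ q ≤ n ∧
      n < 2 * ((4 * g + 1) * m) + ∑ q ∈ Finset.range N, 8 ^ ℓ q + 8 ∧
      ∑ q ∈ Finset.range N, 2 ^ ℓ q ≤ 2 ^ J * (k * (8 * g + 7 + 8 * (2 * g) ^ 3)) ∧
      1 ≤ J ∧ 8 ^ J * ((2 * g) ^ 3 * k) ≤ n := by
  set L : ℕ := (2 * g) ^ 3 with hL
  have hLpos : 0 < L := by positivity
  have hLk : 0 < L * k := by positivity
  -- The top level is the largest for which `L * k` segments of length `8 ^ J` fit into `n`;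
  -- maximality bounds the number of top-level segments by a multiple of `k`.
  set J := Nat.log 8 (n / (L * k)) with hJdef
  have hdiv8 : 8 ≤ n / (L * k) := (Nat.le_div_iff_mul_le hLk).2 hkn
  have hJ1 : 1 ≤ J := Nat.log_pos (by norm_num) hdiv8
  have hJle : 8 ^ J * (L * k) ≤ n :=
    (Nat.le_div_iff_mul_le hLk).1 (Nat.pow_log_le_self 8 (by omega))
  have hJlt : n < 8 ^ (J + 1) * (L * k) :=
    (Nat.div_lt_iff_lt_mul hLk).1 (Nat.lt_pow_succ_log_self (by norm_num) _)
  set a₀ : ℕ := (4 * g + 1) * m with ha₀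
  have hg3 : 5 * 5 * g ≤ g ^ 3 := by
    rw [pow_succ, pow_two]; gcongr
  have ha₀n : 4 * a₀ ≤ n := by
    have h1 : a₀ ≤ (4 * g + 1) * k := Nat.mul_le_mul_left _ hmk
    have h2 : 4 * (4 * g + 1) ≤ 8 * L := by rw [hL, mul_pow]; omega
    nlinarith
  have hR : 2 * (4 * g * k) * 8 ^ J ≤ 7 * (n - 2 * a₀) := by
    have h2 : 2 * (8 * g) ≤ L := by rw [hL, mul_pow]; omega
    have h3 : 2 * (8 * g) * (8 ^ J * k) ≤ L * (8 ^ J * k) := Nat.mul_le_mul_right _ h2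
    have h4 : 2 * (2 * (4 * g * k) * 8 ^ J) ≤ n := by nlinarith
    omega
  obtain ⟨T, S, ⟨N, ℓ, h, hs, h0, hN, hTsum, hSsum⟩, hT1, hT2, hS⟩ :=
    exists_schedule (g := g) hJ1 hR
  have hSK : S ≤ 2 ^ J * (k * (8 * g + 7 + 8 * L)) := by
    refine hS.trans (Nat.mul_le_mul_left _ ?_)
    have h1 : (n - 2 * a₀) / 8 ^ J ≤ 8 * (L * k) := by
      refine (Nat.div_le_div_right (Nat.sub_le _ _)).trans ?_
      refine (Nat.div_lt_of_lt_mul ?_).le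
      rw [pow_succ] at hJlt
      linarith
    nlinarith
  exact ⟨J, N, ℓ, h, hs, h0, hN, by omega, by omega, hSsum.trans_le hSK, hJ1, hJle⟩

theorem HasDisjointPaths.mono {n m : ℕ} {T W W' : ℝ} {ξ : ℤ × ℤ → ℝ}
    (h : HasDisjointPaths n m T W ξ) (hW : W' ≤ W) : HasDisjointPaths n m T W' ξ := by
  obtain ⟨γ, h1, h2, h3, h4⟩ := h
  exact ⟨γ, h1, h2, h3, hW.trans h4⟩

/-- Besides the deficit `y`, the only loss is the length not covered by segments, of order `k` for
each path, at rate `μ`. -/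
theorem hasDisjointPaths_of_deficit_lt {J k N m M n : ℕ} {ℓ h : ℕ → ℕ} {μ δ y : ℝ}
    {ξ : ℤ × ℤ → ℝ} (hM : 2 ≤ M) (hm : 1 ≤ m) (hmk : m ≤ k) (hμ : 0 ≤ μ)
    (hs : IsSchedule J (4 * (2 * M + 1) * k * (2 * M + 1)) (2 * M + 1) N ℓ h)
    (h0 : h 0 = 4 * (2 * M + 1) * k * (2 * M + 1) * 4)
    (hN : h N = 4 * (2 * M + 1) * k * (2 * M + 1) * 4)
    (hT : 2 * ((4 * (2 * M + 1) + 1) * m) + ∑ q ∈ Finset.range N, 8 ^ ℓ q ≤ n)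
    (hT' : n < 2 * ((4 * (2 * M + 1) + 1) * m) + ∑ q ∈ Finset.range N, 8 ^ ℓ q + 8)
    (hJ : 1 ≤ J) (hδ : 2 * ((2 * M + 1 : ℕ) : ℝ) * 2 ^ J ≤ δ) (hξ : ∀ w, 0 ≤ ξ w)
    (hy : ∑ i : Fin m, ∑ q ∈ Finset.range N, (μ * 8 ^ ℓ q - segPassage M (ℓ q)
      (wayDisp (4 * (2 * M + 1) * k) h i q)
      (wayPoint ((4 * (2 * M + 1) + 1) * m) (4 * (2 * M + 1) * k) ℓ h i q) ξ) < y) :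
    HasDisjointPaths n m (2 * m * δ ^ 2)
      (μ * n * m - μ * (10 * (2 * M + 1) + 8) * m * k - y) ξ := by
  obtain ⟨V, hV, hVdisj, hVtf, hVw⟩ := exists_disjoint_pathSets (by omega) hmk hm hs h0 hN hT hT' ξ
  have hM' : (2 : ℝ) ≤ M := by exact_mod_cast hM
  have hmr : (1 : ℝ) ≤ m := by exact_mod_cast hm
  refine hasDisjointPaths_of_pathSets hξ V hV hVdisj (fun i v hv => ?_) ?_
  · have h2J : (2 : ℝ) ≤ 2 ^ J := by
      calc (2 : ℝ) = 2 ^ 1 := by norm_num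
        _ ≤ 2 ^ J := pow_le_pow_right₀ (by norm_num) hJ
    have h4J : (4 : ℝ) ^ J = (2 ^ J) ^ 2 := by rw [← pow_mul, mul_comm, pow_mul]; norm_num
    push_cast at hδ
    have h5 : (2 * (2 * M + 1 : ℝ) * 2 ^ J) ^ 2 ≤ δ ^ 2 := by gcongr
    have h6 : (2 * M + 1 : ℝ) * 4 ^ J ≤ δ ^ 2 := by
      refine le_trans ?_ h5
      rw [h4J, mul_pow, mul_pow]
      have : (2 * M + 1 : ℝ) ≤ 2 ^ 2 * (2 * M + 1) ^ 2 := by nlinarith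
      gcongr
    have h7 : 4 * (2 * M + 1 : ℝ) + 5 ≤ δ ^ 2 := by
      refine le_trans ?_ h5
      have : (2 * (2 * M + 1 : ℝ) * 2) ^ 2 ≤ (2 * (2 * M + 1 : ℝ) * 2 ^ J) ^ 2 := by gcongr
      nlinarith
    rcases hVtf i v hv with hv | hv
    · have h8 : |((v.2 - v.1 : ℤ) : ℝ)| ≤ 2 * ((4 * (2 * M + 1) + 1) * m) + 8 := by
        exact_mod_cast hv
      have h9 := mul_le_mul_of_nonneg_left h7 (by positivity : (0 : ℝ) ≤ 2 * m)
      linarith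
    · have h8 : |((v.2 - v.1 : ℤ) : ℝ)| ≤ 2 * m * ((2 * M + 1) * 4 ^ J) := by exact_mod_cast hv
      exact h8.trans (mul_le_mul_of_nonneg_left h6 (by positivity))
  · have h1 := Finset.sum_le_sum fun i (_ : i ∈ Finset.univ) => hVw i
    set T : ℕ := ∑ q ∈ Finset.range N, 8 ^ ℓ q with hTsum
    have h2 : ∑ _i : Fin m, ∑ q ∈ Finset.range N, μ * (8 : ℝ) ^ ℓ q = μ * (m * T) := by
      rw [Finset.sum_const, Finset.card_univ, Fintype.card_fin, nsmul_eq_mul, ← Finset.mul_sum,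
        hTsum]
      push_cast
      ring
    have h3 : (n : ℝ) ≤ T + (10 * (2 * M + 1) + 8) * k := by
      have h4 : 2 * ((4 * (2 * M + 1) + 1) * m) + 8 ≤ (10 * (2 * M + 1) + 8) * k := by
        have : (4 * (2 * M + 1) + 1) * m ≤ (4 * (2 * M + 1) + 1) * k := Nat.mul_le_mul_left _ hmk
        nlinarith
      have : n ≤ T + (10 * (2 * M + 1) + 8) * k := by omega
      exact_mod_cast this
    have h4 : μ * m * n ≤ μ * m * (T + (10 * (2 * M + 1) + 8) * k) := by gcongr
    have h5 : ∑ i : Fin m, ∑ q ∈ Finset.range N, (μ * (8 : ℝ) ^ ℓ q - segPassage M (ℓ q)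
        (wayDisp (4 * (2 * M + 1) * k) h i q)
        (wayPoint ((4 * (2 * M + 1) + 1) * m) (4 * (2 * M + 1) * k) ℓ h i q) ξ)
        = μ * (m * T) - ∑ i : Fin m, ∑ q ∈ Finset.range N, segPassage M (ℓ q)
        (wayDisp (4 * (2 * M + 1) * k) h i q)
        (wayPoint ((4 * (2 * M + 1) + 1) * m) (4 * (2 * M + 1) * k) ℓ h i q) ξ := by
      rw [← h2, ← Finset.sum_sub_distrib]
      exact Finset.sum_congr rfl fun i _ => Finset.sum_sub_distrib _ _
    rw [h5] at hy
    linarith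

end LPP

end

theorem theoremt (ν : MeasureTheory.Measure ℝ) [MeasureTheory.IsProbabilityMeasure ν]
    (hsupp : ν (Set.Iio 0) = 0)
    (h₁ : LPP.NoAtomFiniteGrowth ν)
    (h₂ : LPP.StrongConcavity ν)
    (h₃ : LPP.DeviationEstimates ν) :
    ∃ c c₁ C₁ : ℝ, 0 < c ∧ 0 < c₁ ∧ 0 < C₁ ∧ ∃ k₀ : ℕ, 1 ≤ k₀ ∧
      ∀ n k m : ℕ, k₀ ≤ k → (k : ℝ) ≤ c₁ * n → 1 ≤ m → m ≤ k →
        1 - Real.exp (-c * k * m) ≤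
          (LPP.envLaw ν).real {ξ | LPP.HasDisjointPaths n m
            (2 * m * (k : ℝ) ^ (-2 / 3 : ℝ) * (n : ℝ) ^ (2 / 3 : ℝ))
            (LPP.growthRate ν * n * m
              - C₁ * m * (k : ℝ) ^ (2 / 3 : ℝ) * (n : ℝ) ^ (1 / 3 : ℝ)) ξ} := by
  obtain ⟨M, hM, κ, hκ, hexp⟩ := LPP.exists_exponential_moment ν hsupp h₂ h₃
  set μ := LPP.growthRate ν with hμdef
  have hμ : 0 ≤ μ := ENNReal.toReal_nonneg
  set g : ℕ := 2 * M + 1 with hg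
  have hg5 : 5 ≤ g := by omega
  -- The cube makes `8 ^ J * L * k ≤ n` equivalent to `2 * g * 2 ^ J ≤ δ`, so the outermost strip
  -- stays within `2 * m * δ ^ 2`. The constant `1 / (8 * L)` below ensures `J ≥ 1`.
  set L : ℕ := (2 * g) ^ 3 with hL
  have hLpos : 0 < L := by positivity
  set K : ℕ := 8 * g + 7 + 8 * L with hK
  refine ⟨1, 1 / (8 * L), μ * (10 * g + 8) + (K + 1) / κ, one_pos, by positivity, by positivity, 1,
    le_rfl, ?_⟩
  intro n k m hk hkn hm hmk
  have hkr : (1 : ℝ) ≤ k := by exact_mod_cast hk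
  have hkn' : 8 * (L * k) ≤ n := by
    rw [one_div, inv_mul_eq_div, le_div_iff₀ (by positivity)] at hkn
    have : (8 * (L * k) : ℝ) ≤ n := by linarith
    exact_mod_cast this
  have hnpos : 0 < n := by
    have : 0 < L * k := by positivity
    omega
  obtain ⟨J, N, ℓ, h, hs, h0, hN, hT1, hT2, hSK, hJ1, hJle⟩ :=
    LPP.exists_scaled_schedule hg5 hk hmk hkn'
  obtain ⟨δ, hδ, hδ3, hδ2, hδ1⟩ := LPP.exists_cube_root (n := n) (k := k) (by omega) hnpos
  have hδJ : 2 * g * 2 ^ J ≤ δ := by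
    have h1 : ((2 * g * 2 ^ J : ℝ)) ^ 3 * k ≤ δ ^ 3 * k := by
      rw [hδ3]
      have h2 : ((8 ^ J * (L * k) : ℕ) : ℝ) ≤ n := by exact_mod_cast hJle
      have h3 : ((2 : ℝ) ^ J) ^ 3 = 8 ^ J := by rw [← pow_mul, mul_comm, pow_mul]; norm_num
      rw [mul_pow, h3]
      rw [hL] at h2
      push_cast at h2
      linarith
    exact le_of_pow_le_pow_left₀ (by norm_num) hδ.le (le_of_mul_le_mul_right h1 (by positivity))
  have h2J : (2 : ℝ) ≤ 2 ^ J := by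
    calc (2 : ℝ) = 2 ^ 1 := by norm_num
      _ ≤ 2 ^ J := pow_le_pow_right₀ (by norm_num) hJ1
  have hgr : (5 : ℝ) ≤ g := by exact_mod_cast hg5
  have h2Jδ : (2 : ℝ) ^ J ≤ δ := by nlinarith
  have hδ1' : 1 ≤ δ := by linarith
  refine (LPP.one_sub_exp_le_measureReal_deficit ν hκ hexp (a₀ := (4 * g + 1) * m) hk hmk hs
    hSK).trans ?_
  -- Weights are nonnegative only almost surely, so the inclusion of events holds up to a null set.
  refine ENNReal.toReal_mono (MeasureTheory.measure_ne_top _ _) (MeasureTheory.measure_mono_ae ?_)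
  filter_upwards [LPP.ae_nonneg_envLaw ν hsupp] with ξ hξ hξE
  have hpaths := LPP.hasDisjointPaths_of_deficit_lt hM hm hmk hμ hs h0 hN hT1 hT2 hJ1 hδJ hξ hξE
  have e1 : 2 * (m : ℝ) * (k : ℝ) ^ (-2 / 3 : ℝ) * (n : ℝ) ^ (2 / 3 : ℝ) = 2 * m * δ ^ 2 := by
    rw [mul_assoc _ ((k : ℝ) ^ _), hδ2]
  have e2 : ∀ C : ℝ, C * m * (k : ℝ) ^ (2 / 3 : ℝ) * (n : ℝ) ^ (1 / 3 : ℝ) = C * m * (k * δ) := by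
    intro C
    rw [mul_assoc _ ((k : ℝ) ^ _), hδ1]
  show LPP.HasDisjointPaths n m _ _ ξ
  rw [e1, e2]
  refine hpaths.mono ?_
  have h5 : (k : ℝ) ≤ k * δ := le_mul_of_one_le_right (by positivity) hδ1'
  have h6 : μ * (10 * g + 8) * m * k ≤ μ * (10 * g + 8) * m * (k * δ) := by gcongr
  have h7 : (K + 1) * m * k * 2 ^ J / κ ≤ (K + 1) / κ * m * (k * δ) := by
    calc (K + 1) * m * k * 2 ^ J / κ = (K + 1) / κ * m * (k * 2 ^ J) := by ring
      _ ≤ _ := by gcongr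
  have h8 : (g : ℝ) = 2 * M + 1 := by rw [hg]; push_cast; ring
  rw [h8] at h6
  rw [h8]
  linarith
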